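/- All graphs are finite and simple. An instance $\mathcal A=(G,I_{\rm init},I_{\rm fin},k)$ of TS-Independent Set Reconfiguration consists of a graph $G$ and two independent sets $I_{\rm init},I_{\rm fin}$ of $G$ of size $k$ (the positions of $k$ tokens). A reconfiguration sequence of length $\ell\ge 0$ for $\mathcal A$ is a sequence $I_{\rm init}=I_0,I_1,\dots,I_\ell=I_{\rm fin}$ of independent sets of size $k$ such that for each $t<\ell$, $I_{t+1}=(I_t\setminus\{u\})\cup\{v\}$ for some edge $uv$ of $G$ with $u\in I_t$, $v\notin I_t$ (a token slides to an empty adjacent vertex). An instance of Partitioned TS-Independent Set Reconfiguration consists of a graph $G$, a partition of its vertex set into token sets $P_1,\dots,P_k$, and two independent sets $I_{\rm init},I_{\rm fin}$, each containing exactly one vertex of every $P_i$. Reconfiguration sequences are defined in the same way, except that every $I_t$ is an independent set containing exactly one vertex of every $P_i$, and $u,v$ must belong to the same token set. In both problems the question is whether a reconfiguration sequence (of any length) exists, and the parameter is the number $k$ of tokens. Instances are encoded by bit strings (the numbers $k$ and $|V(G)|$ in unary, the adjacency matrix, the incidence matrix of vertices and token sets in the partitioned case, and the characteristic vectors of $I_{\rm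 init}$ and $I_{\rm fin}$). A pl-reduction (parameterized logspace reduction) from a problem $Q_1$ to a problem $Q_2$ is a function $f$ from the instances of $Q_1$ to those of $Q_2$ such that (a) $\mathcal A$ is a yes-instance if and only if $f(\mathcal A)$ is; (b) the parameter of $f(\mathcal A)$ is at most $h(k)$ for a computable function $h$, where $k$ is the parameter of $\mathcal A$; and (c) $f$ is computed by a deterministic Turing machine (read-only input, work tapes, write-only output) using work space $O(g(k)+\log n)$, where $g$ is a computable function and $n$ is the number of bits of the encoding of $\mathcal A$. **Lemma.** There is a pl-reduction $f$ from TS-Independent Set Reconfiguration to Partitioned TS-Independent Set Reconfiguration such that for every instance $\mathcal A$ of TS-Independent Set Reconfiguration with $k$ tokens and every integer $\ell\ge 0$: $\mathcal A$ admits a reconfiguration sequence of length at most $\ell$ if and only if $f(\mathcal A)$ admits a reconfiguration sequence of length at most $\ell+k+1$; moreover, if $\mathcal A$ admits a reconfiguration sequence of length exactly $\ell$, then $f(\mathcal A)$ admits one of length exactly $\ell+k+1$. -/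

import Mathlib

namespace Reconf

/-! ## Space-bounded computation: deterministic multi-tape Turing machines with a read-only
two-way input tape, read-write work tapes, and a write-only output tape. -/

/-- What an input head can read: one of the two end markers, or a bit of the input. -/
inductive InSym where
  | leftEnd : InSym
  | bit : Bool → InSym
  | rightEnd : InSym

inductive Move where
  | left : Move
  | stay : Move
  | right : Move

/-- What a machine does in one step: new state, move of the input head, the symbol written on each
work tape, the move of each work head, and at most one bit appended to the output. -/
structure Action (State Work Sym : Type) where
  state : State
  moveIn : Move
  write : Work → Sym
  move : Work → Move
  emit : Option Bool

/-- A deterministic Turing transducer, with finitely many states, finitely many work tapes (indexed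
by `Work`) and a finite work alphabet `Sym`. The machine halts when `δ` returns `none`. -/
structure Transducer where
  State : Type
  Work : Type
  Sym : Type
  [finiteState : Finite State]
  [finiteWork : Finite Work]
  [finiteSym : Finite Sym]
  blank : Sym
  start : State
  δ : State → InSym → (Work → Sym) → Option (Action State Work Sym)

namespace Transducer

/-- Configurations. Position `0` of the input head is the left end marker, positions `1, …, |x|`
are the bits of the input `x`, and position `|x| + 1` is the right end marker. Work tapes are
one-way infinite, with cells `0, 1, 2, …`. -/
@[ext]
structure Cfg (M : Transducer) where
  state : M.State
  posIn : ℕ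
  tape : M.Work → ℕ → M.Sym
  head : M.Work → ℕ
  out : List Bool

/-- The symbol at position `p` of the input tape holding `x`. -/
def inSym (x : List Bool) : ℕ → InSym
  | 0 => InSym.leftEnd
  | p + 1 => match x[p]? with
    | some b => InSym.bit b
    | none => InSym.rightEnd

/-- Moving a head on a one-way infinite tape; a left move on the leftmost cell has no effect. -/
def moveHead : Move → ℕ → ℕ
  | Move.left, p => p - 1
  | Move.stay, p => p
  | Move.right, p => p + 1

variable (M : Transducer)

def initCfg : M.Cfg where
  state := M.start
  posIn := 0
  tape := fun _ _ => M.blank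
  head := fun _ => 0
  out := []

/-- One step on input `x`. The input head never leaves the positions `0, …, |x| + 1`. -/
def step (x : List Bool) (c : M.Cfg) : Option M.Cfg :=
  (M.δ c.state (inSym x c.posIn) (fun i => c.tape i (c.head i))).map fun a =>
    { state := a.state
      posIn := min (moveHead a.moveIn c.posIn) (x.length + 1)
      tape := fun i => Function.update (c.tape i) (c.head i) (a.write i)
      head := fun i => moveHead (a.move i) (c.head i)
      out := c.out ++ a.emit.toList }

/-- On input `x` the machine halts with output `y`, and during the whole computation each work
head stays on the first `s` cells of its tape. -/
def ComputesInSpace (x y : List Bool) (s : ℕ) : Prop :=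
  (∃ c, StateTransition.Reaches (M.step x) M.initCfg c ∧ M.step x c = none ∧ c.out = y) ∧
  ∀ c, StateTransition.Reaches (M.step x) M.initCfg c → ∀ i, c.head i < s

end Transducer

/-! ## Parameterized problems and parameterized logspace reductions -/

/-- A parameterized decision problem: its instances, their parameter, an encoding of the instances
by bit strings, and the yes-instances. -/
structure ParamProblem where
  Inst : Type
  param : Inst → ℕ
  encode : Inst → List Bool
  encode_injective : Function.Injective encode
  Yes : Inst → Prop

/-- `f` is a pl-reduction from `P` to `Q`: it preserves and reflects yes-instances, the new
parameter is bounded by a computable function of the old one, and `f` is computed by a machine that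
uses space `O(g(k) + log n)`, where `k` is the parameter, `n` is the number of bits of the input
and `g` is a computable function. -/
def IsPLReduction (P Q : ParamProblem) (f : P.Inst → Q.Inst) : Prop :=
  (∀ A, P.Yes A ↔ Q.Yes (f A)) ∧
  (∃ h : ℕ → ℕ, Computable h ∧ ∀ A, Q.param (f A) ≤ h (P.param A)) ∧
  (∃ g : ℕ → ℕ, Computable g ∧ ∃ (M : Transducer) (c : ℕ), ∀ A,
    M.ComputesInSpace (P.encode A) (Q.encode (f A))
      (c * (g (P.param A) + Nat.log 2 (P.encode A).length)))

/-! ## Encoding of graphs and vertex sets -/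

/-- A number in unary, followed by a delimiter. -/
def encUnary (m : ℕ) : List Bool := List.replicate m true ++ [false]

open Classical in
/-- The `a × b` truth table of a binary relation, row by row. -/
noncomputable def encRel {a b : ℕ} (R : Fin a → Fin b → Prop) : List Bool :=
  (List.ofFn fun i => List.ofFn fun j => decide (R i j)).flatten

open Classical in
/-- The characteristic vector of a set. -/
noncomputable def encSet {a : ℕ} (S : Finset (Fin a)) : List Bool :=
  List.ofFn fun i => decide (i ∈ S)

theorem encUnary_append_inj {m m' : ℕ} {l l' : List Bool}
    (h : encUnary m ++ l = encUnary m' ++ l') : m = m' ∧ l = l' := by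
  induction m generalizing m' with
  | zero => cases m' <;> simp_all [encUnary, List.replicate_succ]
  | succ m ih =>
    cases m' with
    | zero => simp [encUnary, List.replicate_succ] at h
    | succ m' =>
      have := @ih m' (by simpa [encUnary, List.replicate_succ] using h)
      exact ⟨by rw [this.1], this.2⟩

theorem length_encSet {a : ℕ} (S : Finset (Fin a)) : (encSet S).length = a := by
  simp [encSet]

theorem length_encRel {a b : ℕ} (R : Fin a → Fin b → Prop) : (encRel R).length = a * b := by
  simp [encRel, List.length_flatten, List.map_ofFn, Function.comp_def]

theorem encSet_inj {a : ℕ} {S T : Finset (Fin a)} (h : encSet S = encSet T) : S = T := by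
  ext i
  have := congrFun (List.ofFn_injective h) i
  simpa using this

theorem encRel_inj {a b : ℕ} {R R' : Fin a → Fin b → Prop} (h : encRel R = encRel R') :
    R = R' := by
  have key := (List.eq_iff_flatten_eq (L := List.ofFn fun i => List.ofFn fun j => _)).2 ⟨h, by
    simp [List.map_ofFn, Function.comp_def]⟩
  funext i j
  have := congrFun (List.ofFn_injective (congrFun (List.ofFn_injective key) i)) j
  simpa using this

/-! ## Reconfiguration -/

/-- There is a reconfiguration sequence `I 0, …, I ℓ` of length `ℓ`, i.e. with `ℓ` moves, from `a`
to `b`, through valid configurations. -/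
def HasSeq {α : Type} (Valid : α → Prop) (Step : α → α → Prop) (a b : α) (ℓ : ℕ) : Prop :=
  ∃ I : ℕ → α, I 0 = a ∧ I ℓ = b ∧ (∀ t ≤ ℓ, Valid (I t)) ∧ ∀ t < ℓ, Step (I t) (I (t + 1))

/-- `T` arises from `S` by sliding a token from `u` along an edge to an empty vertex `v`. -/
def Slide {n : ℕ} (G : SimpleGraph (Fin n)) (S T : Finset (Fin n)) : Prop :=
  ∃ u ∈ S, ∃ v ∉ S, G.Adj u v ∧ T = insert v (S.erase u)

/-- As `Slide`, with the token staying within its token set (`part v` is the index of the token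
set that contains `v`). -/
def PartSlide {n k : ℕ} (G : SimpleGraph (Fin n)) (part : Fin n → Fin k)
    (S T : Finset (Fin n)) : Prop :=
  ∃ u ∈ S, ∃ v ∉ S, G.Adj u v ∧ part u = part v ∧ T = insert v (S.erase u)

/-- An independent set of size `k`. -/
def IsIndep {n : ℕ} (G : SimpleGraph (Fin n)) (k : ℕ) (S : Finset (Fin n)) : Prop :=
  G.IsIndepSet (S : Set (Fin n)) ∧ S.card = k

/-- An independent set with exactly one vertex in each of the `k` token sets. -/
def IsPartIndep {n k : ℕ} (G : SimpleGraph (Fin n)) (part : Fin n → Fin k)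
    (S : Finset (Fin n)) : Prop :=
  G.IsIndepSet (S : Set (Fin n)) ∧ ∀ i : Fin k, ∃! v, v ∈ S ∧ part v = i

/-- Instances of TS-Independent Set Reconfiguration: a graph on `n` vertices with an initial and a
final independent set of size `k`. -/
structure TSInst where
  n : ℕ
  k : ℕ
  G : SimpleGraph (Fin n)
  start : Finset (Fin n)
  goal : Finset (Fin n)
  start_indep : IsIndep G k start
  goal_indep : IsIndep G k goal

/-- Instances of Partitioned TS-Independent Set Reconfiguration: a graph on `n` vertices, a
partition of the vertices into `k` token sets, and an initial and a final independent set with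
exactly one token in each token set. -/
structure PTSInst where
  n : ℕ
  k : ℕ
  G : SimpleGraph (Fin n)
  part : Fin n → Fin k
  start : Finset (Fin n)
  goal : Finset (Fin n)
  start_indep : IsPartIndep G part start
  goal_indep : IsPartIndep G part goal

/-- The instance admits a reconfiguration sequence of length `ℓ`. -/
def TSInst.Admits (A : TSInst) (ℓ : ℕ) : Prop :=
  HasSeq (IsIndep A.G A.k) (Slide A.G) A.start A.goal ℓ

/-- The instance admits a reconfiguration sequence of length `ℓ`. -/
def PTSInst.Admits (A : PTSInst) (ℓ : ℕ) : Prop :=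
  HasSeq (IsPartIndep A.G A.part) (PartSlide A.G A.part) A.start A.goal ℓ

/-- Number of tokens, number of vertices, adjacency matrix, initial set, final set. -/
noncomputable def TSInst.encode (A : TSInst) : List Bool :=
  encUnary A.k ++ (encUnary A.n ++ (encRel A.G.Adj ++ (encSet A.start ++ encSet A.goal)))

/-- Number of tokens, number of vertices, adjacency matrix, incidence matrix of vertices and token
sets, initial set, final set. -/
noncomputable def PTSInst.encode (A : PTSInst) : List Bool :=
  encUnary A.k ++ (encUnary A.n ++ (encRel A.G.Adj ++
    (encRel (fun v i => A.part v = i) ++ (encSet A.start ++ encSet A.goal))))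

theorem TSInst.encode_injective : Function.Injective TSInst.encode := by
  rintro ⟨n, k, G, s, g, hs, hg⟩ ⟨n', k', G', s', g', hs', hg'⟩ h
  simp only [TSInst.encode] at h
  obtain ⟨hk, e1⟩ := encUnary_append_inj h
  obtain ⟨hn, e2⟩ := encUnary_append_inj e1
  subst hk hn
  obtain ⟨h1, h⟩ := List.append_inj e2 (by simp only [length_encRel])
  obtain ⟨h2, h3⟩ := List.append_inj h (by simp only [length_encSet])
  obtain rfl := SimpleGraph.ext (encRel_inj h1)
  obtain rfl := encSet_inj h2
  obtain rfl := encSet_inj h3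
  rfl

theorem PTSInst.encode_injective : Function.Injective PTSInst.encode := by
  rintro ⟨n, k, G, p, s, g, hs, hg⟩ ⟨n', k', G', p', s', g', hs', hg'⟩ h
  simp only [PTSInst.encode] at h
  obtain ⟨hk, e1⟩ := encUnary_append_inj h
  obtain ⟨hn, e2⟩ := encUnary_append_inj e1
  subst hk hn
  obtain ⟨h1, h⟩ := List.append_inj e2 (by simp only [length_encRel])
  obtain ⟨h4, h⟩ := List.append_inj h (by simp only [length_encRel])
  obtain ⟨h2, h3⟩ := List.append_inj h (by simp only [length_encSet])
  obtain rfl := SimpleGraph.ext (encRel_inj h1)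
  obtain rfl := encSet_inj h2
  obtain rfl := encSet_inj h3
  have hp : p = p' := by
    funext v
    have := congrFun (congrFun (encRel_inj h4) v) (p v)
    simpa [eq_comm] using this
  subst hp
  rfl

/-- TS-Independent Set Reconfiguration, parameterized by the number of tokens. -/
noncomputable def TSIndepSetReconf : ParamProblem where
  Inst := TSInst
  param := TSInst.k
  encode := TSInst.encode
  encode_injective := TSInst.encode_injective
  Yes := fun A => ∃ ℓ, A.Admits ℓ

/-- Partitioned TS-Independent Set Reconfiguration, parameterized by the number of tokens. -/
noncomputable def PartTSIndepSetReconf : ParamProblem where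
  Inst := PTSInst
  param := PTSInst.k
  encode := PTSInst.encode
  encode_injective := PTSInst.encode_injective
  Yes := fun A => ∃ ℓ, A.Admits ℓ

end Reconf

/-!
The reduction replaces the `k` interchangeable tokens of an instance on a graph `G` with `n`
vertices by `k` distinguishable ones. Token `i` moves in a block of its own, a copy of `G`; copies
of equal or adjacent vertices in different blocks are adjacent, so that the positions of the tokens
always form an independent set of `G` of size `k`. Distinguishable tokens may reach the final set
in any order, whereas the new instance must name one final position for each of them. Therefore
each block has a parking vertex, adjacent to the copies of the final set, and an additional token
operates a switch. While the switch is closed, no token can be parked. When it is opened, all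
tokens have to be on the final set, and afterwards they can be parked in any order. Opening
the switch takes one move and parking takes `k` moves, which accounts for the `k + 1` extra moves.
A sequence for the original instance lifts to the new one (`hasSeq_lift`). In the other direction,
the moves before the switch is first opened form a sequence for the original instance, and at
least `k + 1` moves remain, because each parking vertex is still empty (`exists_hasSeq_of_lift`).

The machine that computes the reduction is put together from fragments (`Frag`) with `bind` and
`loop`. Its work tapes are registers which hold numbers in bijective base 2 and which can be
incremented, erased and compared; loops run a register up to the value of another one. The
numbers `k` and `n` are read from the input. Every bit of the matrices and vectors in the output
belongs to a pair of vertices, to a vertex and a token set, or to a vertex; the machine runs through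
them with a bounded number of nested loops and finds the bit by comparisons and by reading single
bits of the input, for which the head walks to the right place by nested loops again. As no register
exceeds the length `N` of the input, a number takes at most `log (N + 1)` cells
(`computesInSpace_reduction`).
-/

namespace Reconf

/-! ### Sequences -/

theorem HasSeq.refl {α : Type} {Valid : α → Prop} {Step : α → α → Prop} {a : α} (h : Valid a) :
    HasSeq Valid Step a a 0 :=
  ⟨fun _ => a, rfl, rfl, fun _ _ => h, fun _ h => absurd h (Nat.not_lt_zero _)⟩

theorem HasSeq.cons {α : Type} {Valid : α → Prop} {Step : α → α → Prop} {a c b : α} {ℓ : ℕ}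
    (ha : Valid a) (hs : Step a c) (h : HasSeq Valid Step c b ℓ) :
    HasSeq Valid Step a b (ℓ + 1) := by
  obtain ⟨I, h0, hl, hv, hst⟩ := h
  refine ⟨fun t => Nat.casesOn t a I, rfl, hl, ?_, ?_⟩
  · rintro (_ | t) ht
    · exact ha
    · exact hv t (by omega)
  · rintro (_ | t) ht
    · simpa [h0] using hs
    · exact hst t (by omega)

theorem hasSeq_zero {α : Type} {Valid : α → Prop} {Step : α → α → Prop} {a b : α} :
    HasSeq Valid Step a b 0 ↔ a = b ∧ Valid a := by
  constructor
  · rintro ⟨I, h0, hl, hv, -⟩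
    exact ⟨h0.symm.trans hl, h0 ▸ hv 0 le_rfl⟩
  · rintro ⟨rfl, h⟩
    exact .refl h

theorem hasSeq_succ {α : Type} {Valid : α → Prop} {Step : α → α → Prop} {a b : α} {ℓ : ℕ} :
    HasSeq Valid Step a b (ℓ + 1) ↔ Valid a ∧ ∃ c, Step a c ∧ HasSeq Valid Step c b ℓ := by
  constructor
  · rintro ⟨I, h0, hl, hv, hst⟩
    refine ⟨h0 ▸ hv 0 (by omega), I 1, h0 ▸ hst 0 (by omega), fun t => I (t + 1), rfl, hl,
      fun t ht => hv _ (by omega), fun t ht => hst _ (by omega)⟩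
  · rintro ⟨ha, c, hs, h⟩
    exact h.cons ha hs

theorem HasSeq.valid_left {α : Type} {Valid : α → Prop} {Step : α → α → Prop} {a b : α} {ℓ : ℕ}
    (h : HasSeq Valid Step a b ℓ) : Valid a := by
  obtain ⟨I, h0, -, hv, -⟩ := h
  exact h0 ▸ hv 0 (Nat.zero_le _)

/-! ### Configurations with one token per block -/

section Blocks

variable {ι π : Type} [Fintype ι] {N K : ℕ} (e : ι × π ≃ Fin N) (σ : ι ≃ Fin K)

/-- The vertex set occupied by the tokens when, for each block `i`, the token of that block is on
its vertex `q i`. Here `e` numbers the pairs (block, vertex of the block). -/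
def tokens (q : ι → π) : Finset (Fin N) := Finset.univ.image fun i => e (i, q i)

/-- No two tokens of `q` are adjacent. -/
def IsFree (H : SimpleGraph (Fin N)) (q : ι → π) : Prop :=
  ∀ i j, ¬ H.Adj (e (i, q i)) (e (j, q j))

variable {e}

theorem mem_tokens {q : ι → π} {i : ι} {v : π} : e (i, v) ∈ tokens e q ↔ q i = v := by
  simp only [tokens, Finset.mem_image, Finset.mem_univ, true_and, e.injective.eq_iff,
    Prod.mk.injEq]
  constructor
  · rintro ⟨j, rfl, rfl⟩; rfl
  · rintro rfl; exact ⟨i, rfl, rfl⟩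

theorem isPartIndep_tokens {H : SimpleGraph (Fin N)} {q : ι → π} :
    IsPartIndep H (fun p => σ (e.symm p).1) (tokens e q) ↔ IsFree e H q := by
  constructor
  · rintro ⟨h, -⟩ i j hij
    exact h (mem_tokens.2 rfl) (mem_tokens.2 rfl) hij.ne hij
  · intro h
    refine ⟨fun x hx y hy _ => ?_, fun k => ⟨e (σ.symm k, q (σ.symm k)), ?_, ?_⟩⟩
    · obtain ⟨i, -, rfl⟩ := Finset.mem_image.1 hx
      obtain ⟨j, -, rfl⟩ := Finset.mem_image.1 hy
      exact h i j
    · exact ⟨mem_tokens.2 rfl, by simp⟩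
    · rintro y ⟨hy, hk⟩
      obtain ⟨i, -, rfl⟩ := Finset.mem_image.1 hy
      obtain rfl : σ i = k := by simpa using hk
      simp

theorem tokens_injective : Function.Injective (tokens (ι := ι) e) := by
  intro q q' h
  funext i
  exact (mem_tokens.1 (h ▸ mem_tokens.2 rfl : e (i, q i) ∈ tokens e q')).symm

variable [DecidableEq ι]

variable (e) in
/-- The token of one block slides along an edge inside its block. -/
def BlockStep (H : SimpleGraph (Fin N)) (q q' : ι → π) : Prop :=
  ∃ i v, H.Adj (e (i, q i)) (e (i, v)) ∧ q' = Function.update q i v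

theorem tokens_update [DecidableEq π] (q : ι → π) (i : ι) (v : π) :
    tokens e (Function.update q i v) = insert (e (i, v)) ((tokens e q).erase (e (i, q i))) := by
  ext x
  obtain ⟨⟨j, w⟩, rfl⟩ := e.surjective x
  simp only [mem_tokens, Finset.mem_insert, Finset.mem_erase, e.injective.eq_iff, Prod.mk.injEq,
    ne_eq]
  by_cases h : j = i
  · subst h
    simp only [Function.update_self, true_and]
    grind
  · simp [h]

theorem partSlide_tokens {H : SimpleGraph (Fin N)} {q : ι → π} {T : Finset (Fin N)} :
    PartSlide H (fun p => σ (e.symm p).1) (tokens e q) T ↔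
      ∃ q', BlockStep e H q q' ∧ T = tokens e q' := by
  classical
  constructor
  · rintro ⟨x, hx, y, hy, hadj, hpart, rfl⟩
    obtain ⟨i, -, rfl⟩ := Finset.mem_image.1 hx
    obtain ⟨⟨j, w⟩, rfl⟩ := e.surjective y
    obtain rfl : i = j := by simpa using hpart
    exact ⟨_, ⟨i, w, hadj, rfl⟩, (tokens_update q i w).symm⟩
  · rintro ⟨_, ⟨i, v, hadj, rfl⟩, rfl⟩
    refine ⟨_, mem_tokens.2 rfl, e (i, v), ?_, hadj, by simp, tokens_update q i v⟩
    rw [mem_tokens]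
    rintro rfl
    exact hadj.ne rfl

/-- Reconfiguration sequences of a partitioned instance whose token sets are the blocks are the
same as sequences of position functions. -/
theorem hasSeq_tokens {H : SimpleGraph (Fin N)} {q q' : ι → π} {ℓ : ℕ} :
    HasSeq (IsPartIndep H (fun p => σ (e.symm p).1)) (PartSlide H (fun p => σ (e.symm p).1))
      (tokens e q) (tokens e q') ℓ ↔ HasSeq (IsFree e H) (BlockStep e H) q q' ℓ := by
  induction ℓ generalizing q with
  | zero => simp only [hasSeq_zero, tokens_injective.eq_iff, isPartIndep_tokens]
  | succ ℓ ih =>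
    simp only [hasSeq_succ, isPartIndep_tokens, partSlide_tokens]
    refine and_congr_right fun _ => ⟨?_, ?_⟩
    · rintro ⟨_, ⟨r, hr, rfl⟩, h⟩
      exact ⟨r, hr, ih.1 h⟩
    · rintro ⟨r, hr, h⟩
      exact ⟨_, ⟨r, hr, rfl⟩, ih.2 h⟩

/-- A step moves only one token, so a sequence is at least as long as the number of tokens that
end elsewhere than they start. -/
theorem card_ne_le_of_hasSeq [DecidableEq π] {H : SimpleGraph (Fin N)} {q q' : ι → π} {ℓ : ℕ}
    (h : HasSeq (IsFree e H) (BlockStep e H) q q' ℓ) :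
    (Finset.univ.filter fun i => q i ≠ q' i).card ≤ ℓ := by
  induction ℓ generalizing q with
  | zero => simp [(hasSeq_zero.1 h).1]
  | succ ℓ ih =>
    obtain ⟨-, _, ⟨i, v, -, rfl⟩, h⟩ := hasSeq_succ.1 h
    refine le_trans (Finset.card_le_card ?_) ((Finset.card_insert_le i _).trans
      (Nat.succ_le_succ (ih h)))
    intro j hj
    by_cases hji : j = i
    · simp [hji]
    · simpa [hji] using hj

end Blocks

/-! ### The partitioned instance -/

section Gadget

variable {n k : ℕ} (G : SimpleGraph (Fin n)) (goal : Finset (Fin n))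

/-- The adjacency relation of the reduction. Block `inl i` is a copy `(inl i, inl v)` of the
vertices of `G` together with a parking vertex `(inl i, inr 0)`; the extra block `inr 0` contains
the switch vertices `(inr 0, inr 0)` (closed) and `(inr 0, inr 1)` (open). All remaining vertices
are isolated. Copies in two blocks exclude each other if they are equal or adjacent in `G`. The
parking vertex of a block is reached from the copies of the final set; it is unavailable while
the switch is closed, and the switch can be open only if every token is parked or on a copy of a
vertex of the final set. -/
def gadgetAdj : (Fin k ⊕ Fin 1) × (Fin n ⊕ Fin 2) → (Fin k ⊕ Fin 1) × (Fin n ⊕ Fin 2) → Prop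
  | (.inl i, .inl v), (.inl j, .inl w) => (i ≠ j ∧ v = w) ∨ G.Adj v w
  | (.inl i, .inl v), (.inl j, .inr 0) => i = j ∧ v ∈ goal
  | (.inl i, .inr 0), (.inl j, .inl w) => i = j ∧ w ∈ goal
  | (.inl _, .inr 0), (.inr _, .inr 0) => True
  | (.inr _, .inr 0), (.inl _, .inr 0) => True
  | (.inl _, .inl v), (.inr _, .inr 1) => v ∉ goal
  | (.inr _, .inr 1), (.inl _, .inl w) => w ∉ goal
  | (.inr _, .inr 0), (.inr _, .inr 1) => True
  | (.inr _, .inr 1), (.inr _, .inr 0) => True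
  | _, _ => False

theorem gadgetAdj_symm (x y : (Fin k ⊕ Fin 1) × (Fin n ⊕ Fin 2)) (h : gadgetAdj G goal x y) :
    gadgetAdj G goal y x := by
  obtain ⟨i | i, v | v⟩ := x <;> obtain ⟨j | j, w | w⟩ := y <;> (try fin_cases v) <;>
    (try fin_cases w) <;> simp_all [gadgetAdj, G.adj_comm, eq_comm]

theorem gadgetAdj_irrefl (x : (Fin k ⊕ Fin 1) × (Fin n ⊕ Fin 2)) : ¬ gadgetAdj G goal x x := by
  obtain ⟨i | i, v | v⟩ := x <;> (try fin_cases v) <;> simp [gadgetAdj]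

/-- The numbering of the vertices, block by block. -/
def vertexEquiv (k n : ℕ) : (Fin k ⊕ Fin 1) × (Fin n ⊕ Fin 2) ≃ Fin ((k + 1) * (n + 2)) :=
  (Equiv.prodCongr finSumFinEquiv finSumFinEquiv).trans finProdFinEquiv

/-- The graph of the reduction. -/
def gadgetGraph (k : ℕ) : SimpleGraph (Fin ((k + 1) * (n + 2))) where
  Adj x y := gadgetAdj G goal ((vertexEquiv k n).symm x) ((vertexEquiv k n).symm y)
  symm := ⟨fun _ _ h => gadgetAdj_symm G goal _ _ h⟩
  loopless := ⟨fun _ h => gadgetAdj_irrefl G goal _ h⟩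

@[simp] theorem gadgetGraph_adj {x y : (Fin k ⊕ Fin 1) × (Fin n ⊕ Fin 2)} :
    (gadgetGraph G goal k).Adj (vertexEquiv k n x) (vertexEquiv k n y) ↔ gadgetAdj G goal x y := by
  simp [gadgetGraph]

/-- Token `i` is on the copy of `p i`, and the switch is in position `c`. -/
def placed (p : Fin k → Fin n) (c : Fin 2) : Fin k ⊕ Fin 1 → Fin n ⊕ Fin 2 :=
  Sum.elim (fun i => .inl (p i)) (fun _ => .inr c)

/-- All tokens are parked, and the switch is open. -/
def parked (k n : ℕ) : Fin k ⊕ Fin 1 → Fin n ⊕ Fin 2 :=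
  Sum.elim (fun _ => .inr 0) (fun _ => .inr 1)

variable {G goal}

theorem isFree_placed_zero {p : Fin k → Fin n} :
    IsFree (vertexEquiv k n) (gadgetGraph G goal k) (placed p 0) ↔
      Function.Injective p ∧ ∀ i j, ¬ G.Adj (p i) (p j) := by
  simp only [IsFree, gadgetGraph_adj, placed, Sum.forall, Sum.elim_inl, Sum.elim_inr, gadgetAdj]
  constructor
  · intro h
    refine ⟨fun i j hij => ?_, fun i j hij => h.1 i |>.1 j (.inr hij)⟩
    by_contra hne
    exact h.1 i |>.1 j (.inl ⟨hne, hij⟩)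
  · rintro ⟨hp, hG⟩
    refine ⟨fun i => ⟨fun j => ?_, fun _ => id⟩, fun _ => ⟨fun _ => id, fun _ => id⟩⟩
    rintro (⟨hne, hij⟩ | hij)
    · exact hne (hp hij)
    · exact hG i j hij

theorem isIndep_image {p : Fin k → Fin n} (hp : Function.Injective p) :
    IsIndep G k (Finset.univ.image p) ↔ ∀ i j, ¬ G.Adj (p i) (p j) := by
  constructor
  · intro h i j hij
    exact h.1 (by simp) (by simp) hij.ne hij
  · intro h
    refine ⟨?_, by simp [Finset.card_image_of_injective _ hp]⟩
    intro x hx y hy _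
    obtain ⟨i, -, rfl⟩ := Finset.mem_image.1 hx
    obtain ⟨j, -, rfl⟩ := Finset.mem_image.1 hy
    exact h i j

theorem isFree_placed_zero_of_isIndep {p : Fin k → Fin n} (hp : Function.Injective p)
    (h : IsIndep G k (Finset.univ.image p)) :
    IsFree (vertexEquiv k n) (gadgetGraph G goal k) (placed p 0) :=
  isFree_placed_zero.2 ⟨hp, (isIndep_image hp).1 h⟩

theorem image_update {p : Fin k → Fin n} (hp : Function.Injective p) (i : Fin k) (v : Fin n) :
    Finset.univ.image (Function.update p i v) =
      insert v ((Finset.univ.image p).erase (p i)) := by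
  ext x
  simp only [Finset.mem_image, Finset.mem_univ, true_and, Finset.mem_insert, Finset.mem_erase]
  constructor
  · rintro ⟨j, rfl⟩
    by_cases hj : j = i
    · simp [hj]
    · simp [hj, hp.eq_iff]
  · rintro (rfl | ⟨hx, j, rfl⟩)
    · exact ⟨i, by simp⟩
    · exact ⟨j, by rw [Function.update_of_ne]; rintro rfl; exact hx rfl⟩

theorem placed_update (p : Fin k → Fin n) (c : Fin 2) (i : Fin k) (v : Fin n) :
    Function.update (placed p c) (.inl i) (.inl v) = placed (Function.update p i v) c := by
  funext x
  obtain j | j := x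
  · by_cases h : j = i
    · subst h; simp [placed]
    · simp [placed, h]
  · simp [placed]

theorem placed_update_switch (p : Fin k → Fin n) (c d : Fin 2) (z : Fin 1) :
    Function.update (placed p c) (.inr z) (.inr d) = placed p d := by
  funext x
  obtain j | j := x
  · simp [placed]
  · simp [placed, Subsingleton.elim j z]

/-- With the switch open and all tokens on the final set, the tokens can be parked one by one;
`D` is the set of tokens that are not parked yet. -/
theorem hasSeq_parked (hgoal : IsIndep G k goal) {p : Fin k → Fin n} (hp : Function.Injective p)
    (hpg : ∀ i, p i ∈ goal) (D : Finset (Fin k)) :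
    HasSeq (IsFree (vertexEquiv k n) (gadgetGraph G goal k))
      (BlockStep (vertexEquiv k n) (gadgetGraph G goal k))
      (Sum.elim (fun i => if i ∈ D then .inl (p i) else .inr 0) (fun _ => .inr 1))
      (parked k n) D.card := by
  have free : ∀ D : Finset (Fin k), IsFree (vertexEquiv k n) (gadgetGraph G goal k)
      (Sum.elim (fun i => if i ∈ D then .inl (p i) else .inr 0) (fun _ => .inr 1)) := by
    intro D
    simp only [IsFree, gadgetGraph_adj, Sum.forall, Sum.elim_inl, Sum.elim_inr]
    refine ⟨fun i => ⟨fun j => ?_, fun _ => ?_⟩, fun _ => ⟨fun j => ?_, fun _ => ?_⟩⟩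
    · split_ifs with hi hj hj
      · rintro (⟨hne, hij⟩ | hij)
        · exact hne (hp hij)
        · exact hgoal.1 (hpg i) (hpg j) hij.ne hij
      · rintro ⟨rfl, -⟩; exact hj hi
      · rintro ⟨rfl, -⟩; exact hi hj
      · exact id
    · split_ifs
      · exact fun h => h (hpg i)
      · exact id
    · split_ifs
      · exact fun h => h (hpg j)
      · exact id
    · exact id
  induction D using Finset.induction_on with
  | empty => exact hasSeq_zero.2 ⟨by simp [parked], free _⟩
  | insert i D hi ih =>
    rw [Finset.card_insert_of_notMem hi]
    refine HasSeq.cons (free _) ⟨.inl i, .inr 0, ?_, ?_⟩ ih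
    · simp [gadgetAdj, hpg]
    · funext x
      obtain j | j := x
      · by_cases h : j = i
        · subst h; simp [hi]
        · simp [h]
      · simp

/-- A sequence for unlabelled tokens lifts to the reduction from every labelling of its first
set, because the labelling with which the tokens arrive at the final set does not matter for
parking them. -/
theorem hasSeq_lift (hgoal : IsIndep G k goal) {p : Fin k → Fin n} (hp : Function.Injective p)
    {ℓ : ℕ} (h : HasSeq (IsIndep G k) (Slide G) (Finset.univ.image p) goal ℓ) :
    HasSeq (IsFree (vertexEquiv k n) (gadgetGraph G goal k))
      (BlockStep (vertexEquiv k n) (gadgetGraph G goal k))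
      (placed p 0) (parked k n) (ℓ + k + 1) := by
  induction ℓ generalizing p with
  | zero =>
    obtain ⟨hpg, hS⟩ := hasSeq_zero.1 h
    have hmem : ∀ i, p i ∈ goal := fun i => hpg ▸ Finset.mem_image_of_mem _ (Finset.mem_univ _)
    refine HasSeq.cons (isFree_placed_zero_of_isIndep hp hS) (c := placed p 1) ?_ ?_
    · exact ⟨.inr 0, .inr 1, by simp [placed, gadgetAdj], (placed_update_switch ..).symm⟩
    · simpa [placed] using hasSeq_parked hgoal hp hmem Finset.univ
  | succ ℓ ih =>
    obtain ⟨hS, T, ⟨u, hu, v, hv, hadj, rfl⟩, hT⟩ := hasSeq_succ.1 h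
    obtain ⟨i, -, rfl⟩ := Finset.mem_image.1 hu
    rw [← image_update hp] at hT
    have hp' : Function.Injective (Function.update p i v) := by
      intro a b hab
      have key : ∀ j, p j ≠ v := fun j hj => hv (hj ▸ Finset.mem_image_of_mem _ (Finset.mem_univ _))
      by_cases ha : a = i <;> by_cases hb : b = i
      · rw [ha, hb]
      · subst ha; simp only [Function.update_self, Function.update_of_ne hb] at hab
        exact absurd hab.symm (key b)
      · subst hb; simp only [Function.update_self, Function.update_of_ne ha] at hab
        exact absurd hab (key a)
      · simp only [Function.update_of_ne ha, Function.update_of_ne hb] at hab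
        exact hp hab
    have := HasSeq.cons (isFree_placed_zero_of_isIndep hp hS)
      (⟨.inl i, .inl v, by simpa [placed, gadgetAdj] using hadj, (placed_update ..).symm⟩ :
        BlockStep (vertexEquiv k n) (gadgetGraph G goal k) (placed p 0) _) (ih hp' hT)
    rwa [show ℓ + 1 + k + 1 = ℓ + k + 1 + 1 by omega]

/-- As long as the switch is closed, the tokens move as in the original instance; when the switch
is opened, they are on the final set, and each of them still has to move to its parking vertex. -/
theorem exists_hasSeq_of_lift (hgoal : IsIndep G k goal) {p : Fin k → Fin n} {m : ℕ}
    (h : HasSeq (IsFree (vertexEquiv k n) (gadgetGraph G goal k))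
      (BlockStep (vertexEquiv k n) (gadgetGraph G goal k)) (placed p 0) (parked k n) m) :
    ∃ ℓ, ℓ + k + 1 ≤ m ∧ HasSeq (IsIndep G k) (Slide G) (Finset.univ.image p) goal ℓ := by
  induction m generalizing p with
  | zero =>
    have := congrFun (hasSeq_zero.1 h).1 (.inr 0)
    simp [placed, parked] at this
  | succ m ih =>
    obtain ⟨hfree, q, ⟨i, v, hadj, rfl⟩, hq⟩ := hasSeq_succ.1 h
    obtain ⟨hp, hind⟩ := isFree_placed_zero.1 hfree
    obtain i | i := i
    · obtain v | v := v
      · have hGadj : G.Adj (p i) v := by simpa [placed, gadgetAdj] using hadj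
        rw [placed_update] at hq
        obtain ⟨hp', hind'⟩ := isFree_placed_zero.1 hq.valid_left
        obtain ⟨ℓ, hℓ, hs⟩ := ih hq
        refine ⟨ℓ + 1, by omega, HasSeq.cons ((isIndep_image hp).2 hind)
          ⟨p i, by simp, v, ?_, hGadj, image_update hp i v⟩ hs⟩
        intro hv
        obtain ⟨j, -, rfl⟩ := Finset.mem_image.1 hv
        by_cases hji : j = i
        · subst hji; exact hGadj.ne rfl
        · exact hji (hp' (by simp [hji]))
      · -- While the switch is closed, a parking vertex is adjacent to an occupied vertex.
        exfalso
        have hv : v = 0 := by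
          fin_cases v
          · rfl
          · simp [placed, gadgetAdj] at hadj
        subst hv
        have := hq.valid_left (.inl i) (.inr 0)
        simp [placed, gadgetAdj] at this
    · have hv : v = .inr 1 := by
        obtain v | v := v
        · simp [placed, gadgetAdj] at hadj
        · fin_cases v
          · simp [placed] at hadj
          · rfl
      subst hv
      rw [placed_update_switch] at hq
      -- The open switch is adjacent to all copies of vertices outside the final set.
      have hmem : ∀ j, p j ∈ goal := by
        intro j
        have := hq.valid_left (.inl j) (.inr 0)
        simpa [placed, gadgetAdj] using this
      have himg : Finset.univ.image p = goal := by
        apply Finset.eq_of_subset_of_card_le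
        · intro x hx
          obtain ⟨j, -, rfl⟩ := Finset.mem_image.1 hx
          exact hmem j
        · rw [hgoal.2, Finset.card_image_of_injective _ hp]; simp
      -- All tokens but the one of the switch still have to move.
      refine ⟨0, ?_, hasSeq_zero.2 ⟨himg, himg ▸ hgoal⟩⟩
      have hcard := card_ne_le_of_hasSeq hq
      have : (Finset.univ.image (Sum.inl : Fin k → Fin k ⊕ Fin 1)) ⊆
          Finset.univ.filter fun i => placed p 1 i ≠ parked k n i := by
        intro x hx
        obtain ⟨j, -, rfl⟩ := Finset.mem_image.1 hx
        exact Finset.mem_filter.2 ⟨Finset.mem_univ _, by simp [placed, parked]⟩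
      have := Finset.card_le_card this
      rw [Finset.card_image_of_injective _ Sum.inl_injective] at this
      simp only [Finset.card_univ, Fintype.card_fin] at this
      omega

theorem isFree_parked :
    IsFree (vertexEquiv k n) (gadgetGraph G goal k) (parked k n) := by
  simp [IsFree, parked, gadgetAdj, Sum.forall]

end Gadget

/-- The labelling of the initial tokens: token `i` is on the `i`-th smallest initial vertex. -/
noncomputable def TSInst.label (A : TSInst) : Fin A.k → Fin A.n :=
  A.start.orderEmbOfFin A.start_indep.2

theorem TSInst.label_injective (A : TSInst) : Function.Injective A.label :=
  (A.start.orderEmbOfFin A.start_indep.2).injective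

theorem TSInst.image_label (A : TSInst) : Finset.univ.image A.label = A.start :=
  A.start.image_orderEmbOfFin_univ A.start_indep.2

theorem TSInst.label_eq_iff (A : TSInst) (i : Fin A.k) (v : Fin A.n) :
    A.label i = v ↔ v ∈ A.start ∧ (A.start.filter (· < v)).card = i := by
  have key : ∀ i, (A.start.filter (· < A.label i)).card = i := by
    intro i
    have : A.start.filter (· < A.label i) = (Finset.Iio i).image A.label := by
      ext x
      rw [← A.image_label]
      simp only [Finset.mem_filter, Finset.mem_image, Finset.mem_univ, true_and, Finset.mem_Iio]
      constructor
      · rintro ⟨⟨j, rfl⟩, hj⟩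
        exact ⟨j, (A.start.orderEmbOfFin A.start_indep.2).lt_iff_lt.1 hj, rfl⟩
      · rintro ⟨j, hj, rfl⟩
        exact ⟨⟨j, rfl⟩, (A.start.orderEmbOfFin A.start_indep.2).lt_iff_lt.2 hj⟩
    rw [this, Finset.card_image_of_injective _ A.label_injective, Fin.card_Iio]
  constructor
  · rintro rfl
    exact ⟨A.start.orderEmbOfFin_mem A.start_indep.2 i, key i⟩
  · rintro ⟨hv, hc⟩
    rw [← A.image_label] at hv
    obtain ⟨j, -, rfl⟩ := Finset.mem_image.1 hv
    rw [key] at hc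
    rw [Fin.ext hc]

/-- The reduction on instances. -/
noncomputable def TSInst.toPTS (A : TSInst) : PTSInst where
  n := (A.k + 1) * (A.n + 2)
  k := A.k + 1
  G := gadgetGraph A.G A.goal A.k
  part := fun p => finSumFinEquiv ((vertexEquiv A.k A.n).symm p).1
  start := tokens (vertexEquiv A.k A.n) (placed A.label 0)
  goal := tokens (vertexEquiv A.k A.n) (parked A.k A.n)
  start_indep := (isPartIndep_tokens _).2 (isFree_placed_zero_of_isIndep A.label_injective
    (A.image_label ▸ A.start_indep))
  goal_indep := (isPartIndep_tokens _).2 isFree_parked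

theorem TSInst.toPTS_admits (A : TSInst) {m : ℕ} :
    A.toPTS.Admits m ↔ HasSeq (IsFree (vertexEquiv A.k A.n) (gadgetGraph A.G A.goal A.k))
      (BlockStep (vertexEquiv A.k A.n) (gadgetGraph A.G A.goal A.k))
      (placed A.label 0) (parked A.k A.n) m :=
  hasSeq_tokens _

theorem TSInst.Admits.toPTS {A : TSInst} {ℓ : ℕ} (h : A.Admits ℓ) :
    A.toPTS.Admits (ℓ + A.k + 1) := by
  rw [A.toPTS_admits]
  refine hasSeq_lift A.goal_indep A.label_injective ?_
  rw [A.image_label]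
  exact h

theorem TSInst.exists_admits_of_toPTS {A : TSInst} {m : ℕ} (h : A.toPTS.Admits m) :
    ∃ ℓ, ℓ + A.k + 1 ≤ m ∧ A.Admits ℓ := by
  obtain ⟨ℓ, hℓ, hs⟩ := exists_hasSeq_of_lift A.goal_indep (A.toPTS_admits.1 h)
  rw [A.image_label] at hs
  exact ⟨ℓ, hℓ, hs⟩

/-! ### Bijective binary notation -/

/-- Successor in bijective base 2, least significant digit first; `false` is the digit 1 and
`true` is the digit 2. -/
def digitSucc : List Bool → List Bool
  | [] => [false]
  | false :: l => true :: l
  | true :: l => false :: digitSucc l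

/-- The bijective base 2 notation of a number. Unlike binary notation it has no leading zeros to
take care of, so that a number has exactly one notation. -/
def digits : ℕ → List Bool
  | 0 => []
  | m + 1 => digitSucc (digits m)

/-- The value of a list of digits. -/
def digitVal : List Bool → ℕ
  | [] => 0
  | b :: l => (bif b then 2 else 1) + 2 * digitVal l

theorem digitVal_digitSucc (l : List Bool) : digitVal (digitSucc l) = digitVal l + 1 := by
  induction l with
  | nil => rfl
  | cons b l ih => cases b <;> simp [digitSucc, digitVal, ih] <;> ring

theorem digitVal_digits (m : ℕ) : digitVal (digits m) = m := by
  induction m with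
  | zero => rfl
  | succ m ih => rw [digits, digitVal_digitSucc, ih]

theorem digits_injective : Function.Injective digits := fun a b h => by
  rw [← digitVal_digits a, h, digitVal_digits]

/-- All digits are at least 1, so `m` digits stand for at least `2 ^ m - 1`. -/
theorem two_pow_length_le (l : List Bool) : 2 ^ l.length ≤ digitVal l + 1 := by
  induction l with
  | nil => simp [digitVal]
  | cons b l ih => cases b <;> simp [digitVal, pow_succ] <;> omega

theorem length_digits_le {m B : ℕ} (h : m ≤ B) : (digits m).length ≤ Nat.log 2 (B + 1) :=
  Nat.le_log_of_pow_le (by norm_num)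
    ((two_pow_length_le _).trans (by rw [digitVal_digits]; omega))

/-- A tape that holds the word `l` on the cells `1, …, |l|`. Cell `0` is blank, so that a head
that moves left over the word recognizes the end of the tape. -/
def tapeOf (l : List Bool) : ℕ → Option Bool
  | 0 => none
  | p + 1 => l[p]?

theorem tapeOf_append (pre post : List Bool) :
    tapeOf (pre ++ post) (pre.length + 1) = post.head? := by
  cases post <;> simp [tapeOf]

theorem update_tapeOf (pre post : List Bool) (b : Bool) :
    Function.update (tapeOf (pre ++ post)) (pre.length + 1) (some b) =
      tapeOf (pre ++ b :: post.tail) := by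
  funext p
  rcases p with _ | p
  · simp [tapeOf]
  · rcases lt_trichotomy p pre.length with h | rfl | h
    · rw [Function.update_of_ne (by omega)]
      simp [tapeOf, List.getElem?_append_left h]
    · simp [tapeOf]
    · rw [Function.update_of_ne (by omega)]
      simp only [tapeOf, List.getElem?_append_right h.le]
      obtain ⟨d, hd⟩ : ∃ d, p - pre.length = d + 1 := ⟨p - pre.length - 1, by omega⟩
      rw [hd]; cases post <;> simp

theorem update_tapeOf_none (l : List Bool) (b : Bool) :
    Function.update (tapeOf (l ++ [b])) (l.length + 1) none = tapeOf l := by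
  funext p
  rcases p with _ | p
  · simp [tapeOf]
  · rcases lt_trichotomy p l.length with h | rfl | h
    · rw [Function.update_of_ne (by omega)]
      simp [tapeOf, List.getElem?_append_left h]
    · simp [tapeOf]
    · rw [Function.update_of_ne (by omega)]
      simp only [tapeOf]
      rw [List.getElem?_eq_none (by simp; omega), List.getElem?_eq_none (by omega)]

/-! ### Machine fragments -/

/-- The tapes, the heads and the output of a machine; the state is kept apart. -/
@[ext]
structure Conf (W : Type) where
  posIn : ℕ
  tape : W → ℕ → Option Bool
  head : W → ℕ
  out : List Bool

/-- The effect of an action on tapes, heads and output. -/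
def Conf.apply {W S : Type} (x : List Bool) (c : Conf W) (a : Action S W (Option Bool)) :
    Conf W where
  posIn := min (Transducer.moveHead a.moveIn c.posIn) (x.length + 1)
  tape := fun i => Function.update (c.tape i) (c.head i) (a.write i)
  head := fun i => Transducer.moveHead (a.move i) (c.head i)
  out := c.out ++ a.emit.toList

/-- The same action with another successor state. -/
def Action.mapState {S S' W Sym : Type} (f : S → S') (a : Action S W Sym) : Action S' W Sym :=
  ⟨f a.state, a.moveIn, a.write, a.move, a.emit⟩

/-- A piece of a machine with work tapes `W` over the alphabet `Option Bool`, to be left through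
one of the exits `E`. A fragment with exits `Unit` is a command, one with exits `Bool` a test. -/
structure Frag (W E : Type) where
  Q : Type
  [finite : Finite Q]
  start : Q
  δ : Q → InSym → (W → Option Bool) → Action (Q ⊕ E) W (Option Bool)

attribute [instance] Frag.finite

namespace Frag

variable {W E E' : Type} {x : List Bool} {s : ℕ}

/-- The action in state `q` and configuration `c`. -/
def act (F : Frag W E) (x : List Bool) (q : F.Q) (c : Conf W) : Action (F.Q ⊕ E) W (Option Bool) :=
  F.δ q (Transducer.inSym x c.posIn) fun i => c.tape i (c.head i)

/-- On input `x`, the fragment runs from state `q` and configuration `c` to the exit `e` and the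
configuration `c'`, with all work heads on the first `s` cells at each step. -/
inductive Steps (F : Frag W E) (x : List Bool) (s : ℕ) : F.Q → Conf W → E → Conf W → Prop
  | exit {q : F.Q} {c : Conf W} {e : E} (hs : ∀ i, c.head i < s)
      (h : (F.act x q c).state = .inr e) : Steps F x s q c e (c.apply x (F.act x q c))
  | next {q : F.Q} {c : Conf W} {q' : F.Q} {e : E} {c' : Conf W} (hs : ∀ i, c.head i < s)
      (h : (F.act x q c).state = .inl q') (ht : Steps F x s q' (c.apply x (F.act x q c)) e c') :
      Steps F x s q c e c'

/-- Run `F`, then the fragment that belongs to the exit through which `F` was left. -/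
def bind [Finite E] (F : Frag W E) (G : E → Frag W E') : Frag W E' where
  Q := F.Q ⊕ (e : E) × (G e).Q
  start := .inl F.start
  δ
    | .inl q, a, w => (F.δ q a w).mapState
        (Sum.elim (fun q' => .inl (.inl q')) fun e => .inl (.inr ⟨e, (G e).start⟩))
    | .inr ⟨e, q⟩, a, w => ((G e).δ q a w).mapState
        (Sum.elim (fun q' => .inl (.inr ⟨e, q'⟩)) .inr)

/-- Run `F` again and again as long as it is left through the exit `true`. -/
def loop (F : Frag W Bool) : Frag W Unit where
  Q := F.Q
  start := F.start
  δ q a w := (F.δ q a w).mapState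
    (Sum.elim .inl fun b => bif b then .inl F.start else .inr ())

theorem Steps.bind_right [Finite E] {F : Frag W E} {G : E → Frag W E'} {e : E} {q : (G e).Q}
    {c c' : Conf W} {e' : E'} (h : (G e).Steps x s q c e' c') :
    (F.bind G).Steps x s (.inr ⟨e, q⟩) c e' c' := by
  induction h with
  | exit hs h => exact .exit (F := F.bind G) (q := .inr ⟨e, _⟩) hs (congrArg (Sum.elim _ _) h)
  | next hs h _ ih => exact .next (F := F.bind G) hs (congrArg (Sum.elim _ _) h) ih

theorem Steps.bind [Finite E] {F : Frag W E} {G : E → Frag W E'} {e : E} {q : F.Q}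
    {c c' c'' : Conf W} {e' : E'} (h : F.Steps x s q c e c')
    (h' : (G e).Steps x s (G e).start c' e' c'') :
    (F.bind G).Steps x s (.inl q) c e' c'' := by
  induction h with
  | exit hs h => exact .next (F := F.bind G) hs (congrArg (Sum.elim _ _) h) h'.bind_right
  | next hs h _ ih => exact .next (F := F.bind G) hs (congrArg (Sum.elim _ _) h) (ih h')

theorem Steps.loop_false {F : Frag W Bool} {q : F.Q} {c c' : Conf W}
    (h : F.Steps x s q c false c') : F.loop.Steps x s q c () c' := by
  generalize he : false = e at h
  induction h with
  | exit hs h => subst he; exact .exit (F := F.loop) hs (congrArg (Sum.elim _ _) h)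
  | next hs h _ ih => exact .next (F := F.loop) hs (congrArg (Sum.elim _ _) h) (ih he)

theorem Steps.loop_true {F : Frag W Bool} {q : F.Q} {c c' c'' : Conf W}
    (h : F.Steps x s q c true c') (h' : F.loop.Steps x s F.start c' () c'') :
    F.loop.Steps x s q c () c'' := by
  generalize he : true = e at h
  induction h with
  | exit hs h => subst he; exact .next (F := F.loop) hs (congrArg (Sum.elim _ _) h) h'
  | next hs h _ ih => exact .next (F := F.loop) hs (congrArg (Sum.elim _ _) h) (ih h' he)

/-- A fragment as a machine that halts at the exits. -/
def toTransducer [Finite W] [Finite E] (F : Frag W E) : Transducer where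
  State := F.Q ⊕ E
  Work := W
  Sym := Option Bool
  blank := none
  start := .inl F.start
  δ
    | .inl q, a, w => some (F.δ q a w)
    | .inr _, _, _ => none

/-- Add a state to a configuration. -/
def cfg [Finite W] [Finite E] (F : Frag W E) (q : F.Q ⊕ E) (c : Conf W) : F.toTransducer.Cfg :=
  ⟨q, c.posIn, c.tape, c.head, c.out⟩

/-- A run of a fragment that ends is the whole computation of the machine, as the machine is
deterministic; hence the bound on the space holds for all configurations that are reached. -/
theorem Steps.reaches [Finite W] [Finite E] {F : Frag W E} {q : F.Q} {c c' : Conf W} {e : E}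
    (h : F.Steps x s q c e c') (hs' : ∀ i, c'.head i < s) :
    StateTransition.Reaches (F.toTransducer.step x) (F.cfg (.inl q) c) (F.cfg (.inr e) c') ∧
      ∀ d, StateTransition.Reaches (F.toTransducer.step x) (F.cfg (.inl q) c) d →
        ∀ i, d.head i < s := by
  have step : ∀ q c, F.toTransducer.step x (F.cfg (.inl q) c) =
      some (F.cfg (F.act x q c).state (c.apply x (F.act x q c))) := fun _ _ => rfl
  have halt : ∀ e c, F.toTransducer.step x (F.cfg (.inr e) c) = none := fun _ _ => rfl
  induction h with
  | @exit q c e hs h =>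
    have hst := step q c
    rw [h] at hst
    refine ⟨.single hst, fun d hd => ?_⟩
    obtain rfl | ⟨d', hd', hd⟩ := Relation.ReflTransGen.cases_head hd
    · exact hs
    · obtain rfl : F.cfg _ _ = d' := Option.some_injective _ (hst.symm.trans hd')
      obtain rfl | ⟨d', hd', -⟩ := Relation.ReflTransGen.cases_head hd
      · exact hs'
      · cases (halt _ _).symm.trans hd'
  | @next q c q' e c' hs h _ ih =>
    have hst := step q c
    rw [h] at hst
    refine ⟨.head hst (ih hs').1, fun d hd => ?_⟩
    obtain rfl | ⟨d', hd', hd⟩ := Relation.ReflTransGen.cases_head hd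
    · exact hs
    · obtain rfl : F.cfg _ _ = d' := Option.some_injective _ (hst.symm.trans hd')
      exact (ih hs').2 d hd

/-! ### Elementary fragments -/

/-- Heads of the tapes in `R` on cell `h`, all others on cell `0`. -/
def heads [DecidableEq W] (R : Finset W) (h : ℕ) : W → ℕ := fun i => if i ∈ R then h else 0

/-- Move the heads of the tapes in `R`. -/
def moveAct [DecidableEq W] {S : Type} (R : Finset W) (st : S) (mv : Move)
    (w : W → Option Bool) : Action S W (Option Bool) :=
  ⟨st, .stay, w, fun i => if i ∈ R then mv else .stay, none⟩

/-- Write on tape `r` and move its head. -/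
def writeAct [DecidableEq W] {S : Type} (r : W) (st : S) (a : Option Bool) (mv : Move)
    (w : W → Option Bool) : Action S W (Option Bool) :=
  moveAct {r} st mv (Function.update w r a)

/-- One step that reads the input, leaves through an exit that depends on the symbol, moves the
input head and possibly emits a bit. -/
def single (mv : Move) (out : Option Bool) (g : InSym → E) : Frag W E where
  Q := Unit
  start := ()
  δ _ a w := ⟨.inr (g a), mv, w, fun _ => .stay, out⟩

/-- Leave at once through the exit `e`. -/
def pure (e : E) : Frag W E := single .stay none fun _ => e

/-- Append a bit to the output. -/
def emit (b : Bool) : Frag W Unit := single .stay (some b) fun _ => ()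

/-- Move the input head to the right. -/
def moveRight : Frag W Unit := single .right none fun _ => ()

/-- States of the fragments that work on one tape: leaving cell `0`, moving to the right over the
word on the tape, and returning. -/
inductive ScanState where
  | start | carry | back

instance : Finite ScanState :=
  Finite.of_surjective (fun i : Fin 3 => match i with
    | 0 => ScanState.start
    | 1 => .carry
    | 2 => .back) (by rintro (_ | _ | _); exacts [⟨0, rfl⟩, ⟨1, rfl⟩, ⟨2, rfl⟩])

/-- Increment the number on tape `r`. -/
def inc [DecidableEq W] (r : W) : Frag W Unit where
  Q := ScanState
  start := .start
  δ
    | .start, _, w => moveAct {r} (.inl .carry) .right w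
    | .carry, _, w => match w r with
      | some true => writeAct r (.inl .carry) (some false) .right w
      | some false => writeAct r (.inl .back) (some true) .left w
      | none => writeAct r (.inl .back) (some false) .left w
    | .back, _, w => match w r with
      | some _ => moveAct {r} (.inl .back) .left w
      | none => moveAct {r} (.inr ()) .stay w

/-- Erase tape `r`, that is, set the number on it to zero. -/
def clear [DecidableEq W] (r : W) : Frag W Unit where
  Q := ScanState
  start := .start
  δ
    | .start, _, w => moveAct {r} (.inl .carry) .right w
    | .carry, _, w => match w r with
      | some _ => moveAct {r} (.inl .carry) .right w
      | none => moveAct {r} (.inl .back) .left w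
    | .back, _, w => match w r with
      | some _ => writeAct r (.inl .back) none .left w
      | none => moveAct {r} (.inr ()) .stay w

/-- States of the comparison of two tapes; on the way back the outcome is part of the state. -/
inductive CmpState where
  | start | compare | back (b : Bool)

instance : Finite CmpState :=
  Finite.of_surjective (fun i : Fin 4 => match i with
    | 0 => CmpState.start
    | 1 => .compare
    | 2 => .back false
    | 3 => .back true) (by
      rintro (_ | _ | (_ | _)); exacts [⟨0, rfl⟩, ⟨1, rfl⟩, ⟨2, rfl⟩, ⟨3, rfl⟩])

/-- Test whether the tapes `r` and `t` hold the same number. -/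
def eqTest [DecidableEq W] (r t : W) : Frag W Bool where
  Q := CmpState
  start := .start
  δ
    | .start, _, w => moveAct {r, t} (.inl .compare) .right w
    | .compare, _, w =>
      if w r = w t then
        if w r = none then moveAct {r, t} (.inl (.back true)) .left w
        else moveAct {r, t} (.inl .compare) .right w
      else moveAct {r, t} (.inl (.back false)) .left w
    | .back b, _, w => match w r with
      | some _ => moveAct {r, t} (.inl (.back b)) .left w
      | none => moveAct {r, t} (.inr b) .stay w

section Elementary

variable [DecidableEq W] {T : W → ℕ → Option Bool} {p : ℕ} {o : List Bool}

theorem heads_zero (R : Finset W) : heads R 0 = fun _ => 0 := by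
  funext i; simp [heads]

theorem heads_lt {R : Finset W} {h : ℕ} (hh : h < s) (i : W) : heads R h i < s := by
  unfold heads; split_ifs <;> omega

theorem apply_moveAct {S : Type} {R : Finset W} {h : ℕ} {st : S} {mv : Move}
    (hp : p ≤ x.length + 1) :
    (Conf.mk p T (heads R h) o).apply x (moveAct R st mv fun i => T i (heads R h i)) =
      ⟨p, T, heads R (Transducer.moveHead mv h), o⟩ := by
  ext i
  · simp [Conf.apply, moveAct, Transducer.moveHead, hp]
  · simp [Conf.apply, moveAct]
  · simp only [Conf.apply, moveAct, heads]
    split_ifs <;> rfl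
  · simp [Conf.apply, moveAct]

theorem apply_writeAct {S : Type} {r : W} {h : ℕ} {st : S} {a : Option Bool} {mv : Move}
    (hp : p ≤ x.length + 1) :
    (Conf.mk p T (heads {r} h) o).apply x (writeAct r st a mv fun i => T i (heads {r} h i)) =
      ⟨p, Function.update T r (Function.update (T r) h a),
        heads {r} (Transducer.moveHead mv h), o⟩ := by
  ext i
  · simp [Conf.apply, writeAct, moveAct, Transducer.moveHead, hp]
  · by_cases hi : i = r
    · subst hi; simp [Conf.apply, writeAct, moveAct, heads]
    · simp [Conf.apply, writeAct, moveAct, hi]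
  · simp only [Conf.apply, writeAct, moveAct, heads]
    split_ifs <;> rfl
  · simp [Conf.apply, writeAct, moveAct]

theorem Steps.next_move {F : Frag W E} {R : Finset W} {h : ℕ} {q q' : F.Q} {mv : Move} {e : E}
    {c' : Conf W} (hp : p ≤ x.length + 1) (hh : h < s)
    (hact : F.act x q ⟨p, T, heads R h, o⟩ =
      moveAct R (.inl q') mv fun i => T i (heads R h i))
    (ht : F.Steps x s q' ⟨p, T, heads R (Transducer.moveHead mv h), o⟩ e c') :
    F.Steps x s q ⟨p, T, heads R h, o⟩ e c' := by
  refine .next (q' := q') (heads_lt hh) (by rw [hact]; rfl) ?_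
  rwa [hact, apply_moveAct hp]

theorem Steps.next_write {F : Frag W E} {r : W} {h : ℕ} {q q' : F.Q} {a : Option Bool} {mv : Move}
    {e : E} {c' : Conf W} (hp : p ≤ x.length + 1) (hh : h < s)
    (hact : F.act x q ⟨p, T, heads {r} h, o⟩ =
      writeAct r (.inl q') a mv fun i => T i (heads {r} h i))
    (ht : F.Steps x s q' ⟨p, Function.update T r (Function.update (T r) h a),
      heads {r} (Transducer.moveHead mv h), o⟩ e c') :
    F.Steps x s q ⟨p, T, heads {r} h, o⟩ e c' := by
  refine .next (q' := q') (heads_lt hh) (by rw [hact]; rfl) ?_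
  rwa [hact, apply_writeAct hp]

theorem Steps.exit_move {F : Frag W E} {R : Finset W} {q : F.Q} {e : E}
    (hp : p ≤ x.length + 1) (hh : 0 < s)
    (hact : F.act x q ⟨p, T, heads R 0, o⟩ =
      moveAct R (.inr e) .stay fun i => T i (heads R 0 i)) :
    F.Steps x s q ⟨p, T, heads R 0, o⟩ e ⟨p, T, heads R 0, o⟩ := by
  have := Steps.exit (F := F) (x := x) (q := q) (c := ⟨p, T, heads R 0, o⟩) (e := e)
    (heads_lt hh) (by rw [hact]; rfl)
  rwa [hact, apply_moveAct hp] at this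

theorem tapeOf_isSome {l : List Bool} {h : ℕ} (hl : h + 1 ≤ l.length) :
    ∃ b, tapeOf l (h + 1) = some b :=
  ⟨l[h], by simp [tapeOf]⟩

theorem read_heads {R : Finset W} {r : W} (hr : r ∈ R) {pre post : List Bool}
    (hT : T r = tapeOf (pre ++ post)) : T r (heads R (pre.length + 1) r) = post.head? := by
  rw [hT, heads, if_pos hr, tapeOf_append]

theorem inc_back {r : W} {l : List Bool} (hT : T r = tapeOf l) (hp : p ≤ x.length + 1) {h : ℕ}
    (hl : h ≤ l.length) (hs : h < s) :
    (inc r).Steps x s .back ⟨p, T, heads {r} h, o⟩ () ⟨p, T, heads {r} 0, o⟩ := by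
  induction h with
  | zero =>
    refine .exit_move hp hs ?_
    simp [act, inc, hT, heads, tapeOf]
  | succ h ih =>
    obtain ⟨b, hb⟩ := tapeOf_isSome hl
    refine .next_move (q' := ScanState.back) (mv := .left) hp hs ?_ (ih (by omega) (by omega))
    simp [act, inc, hT, heads, hb]

/-- The digits before the head, `pre`, have been dealt with, and a carry is to be added to the rest
of the number, `post`. -/
theorem inc_carry {r : W} (pre post : List Bool) (hT : T r = tapeOf (pre ++ post))
    (hp : p ≤ x.length + 1) (hs : pre.length + post.length + 1 < s) :
    (inc r).Steps x s .carry ⟨p, T, heads {r} (pre.length + 1), o⟩ ()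
      ⟨p, Function.update T r (tapeOf (pre ++ digitSucc post)), heads {r} 0, o⟩ := by
  induction post generalizing pre T with
  | nil =>
    refine .next_write (q' := ScanState.back) (a := some false) (mv := .left) hp
      (by simp at hs; omega) ?_ ?_
    · simp only [act, inc, read_heads (Finset.mem_singleton_self r) hT, List.head?_nil]
    · rw [hT, update_tapeOf]
      exact inc_back (l := pre ++ [false]) (by simp) hp (by simp [Transducer.moveHead])
        (by simp [Transducer.moveHead]; omega)
  | cons b post ih =>
    cases b
    · refine .next_write (q' := ScanState.back) (a := some true) (mv := .left) hp
        (by simp at hs; omega) ?_ ?_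
      · simp only [act, inc, read_heads (Finset.mem_singleton_self r) hT, List.head?_cons]
      · rw [hT, update_tapeOf]
        exact inc_back (l := pre ++ true :: post) (by simp) hp (by simp [Transducer.moveHead])
          (by simp [Transducer.moveHead]; omega)
    · refine .next_write (q' := ScanState.carry) (a := some false) (mv := .right) hp
        (by simp at hs; omega) ?_ ?_
      · simp only [act, inc, read_heads (Finset.mem_singleton_self r) hT, List.head?_cons]
      · rw [hT, update_tapeOf]
        have := @ih (Function.update T r (tapeOf (pre ++ false :: post))) (pre ++ [false])
          (by simp) (by simp at hs ⊢; omega)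
        simpa [digitSucc, Transducer.moveHead] using this

theorem clear_back {r : W} {l : List Bool} (hT : T r = tapeOf l) (hp : p ≤ x.length + 1)
    (hs : l.length < s) :
    (clear r).Steps x s .back ⟨p, T, heads {r} l.length, o⟩ ()
      ⟨p, Function.update T r (tapeOf []), heads {r} 0, o⟩ := by
  induction l using List.reverseRecOn generalizing T with
  | nil =>
    rw [← hT, Function.update_eq_self]
    refine .exit_move hp hs ?_
    simp [act, clear, hT, heads, tapeOf]
  | append_singleton l b ih =>
    simp only [List.length_append, List.length_singleton] at hs ⊢
    refine .next_write (q' := ScanState.back) (a := none) (mv := .left) hp hs ?_ ?_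
    · have : T r (l.length + 1) = some b := by rw [hT, tapeOf_append]; rfl
      simp [act, clear, heads, this]
    · rw [hT, update_tapeOf_none]
      simpa [Transducer.moveHead] using @ih (Function.update T r (tapeOf l)) (by simp) (by omega)

theorem clear_scan {r : W} (pre post : List Bool) (hT : T r = tapeOf (pre ++ post))
    (hp : p ≤ x.length + 1) (hs : pre.length + post.length + 1 < s) :
    (clear r).Steps x s .carry ⟨p, T, heads {r} (pre.length + 1), o⟩ ()
      ⟨p, Function.update T r (tapeOf []), heads {r} 0, o⟩ := by
  induction post generalizing pre with
  | nil =>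
    refine .next_move (q' := ScanState.back) (mv := .left) hp (by simp at hs; omega) ?_
      (clear_back (l := pre) (by simpa using hT) hp (by omega))
    simp only [act, clear, read_heads (Finset.mem_singleton_self r) hT, List.head?_nil]
  | cons b post ih =>
    have := ih (pre ++ [b]) (by simpa using hT) (by simp at hs ⊢; omega)
    refine .next_move (q' := ScanState.carry) (mv := .right) hp (by simp at hs; omega) ?_
      (by simpa [Transducer.moveHead] using this)
    simp only [act, clear, read_heads (Finset.mem_singleton_self r) hT, List.head?_cons]

theorem eqTest_back {r t : W} {b : Bool} {l : List Bool} (hT : T r = tapeOf l)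
    (hp : p ≤ x.length + 1) {h : ℕ} (hl : h ≤ l.length) (hs : h < s) :
    (eqTest r t).Steps x s (.back b) ⟨p, T, heads {r, t} h, o⟩ b
      ⟨p, T, heads {r, t} 0, o⟩ := by
  induction h with
  | zero =>
    refine .exit_move hp hs ?_
    simp [act, eqTest, hT, heads, tapeOf]
  | succ h ih =>
    obtain ⟨a, ha⟩ := tapeOf_isSome hl
    refine .next_move (q' := CmpState.back b) (mv := .left) hp hs ?_ (ih (by omega) (by omega))
    simp [act, eqTest, hT, heads, ha]

/-- The two numbers agree on the digits `pre` before the heads, and `l` and `l'` remain to be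
compared. -/
theorem eqTest_compare {r t : W} (pre l l' : List Bool) (hr : T r = tapeOf (pre ++ l))
    (ht : T t = tapeOf (pre ++ l')) (hp : p ≤ x.length + 1)
    (hs : pre.length + l.length + 1 < s) :
    (eqTest r t).Steps x s .compare ⟨p, T, heads {r, t} (pre.length + 1), o⟩ (decide (l = l'))
      ⟨p, T, heads {r, t} 0, o⟩ := by
  have hmem : r ∈ ({r, t} : Finset W) ∧ t ∈ ({r, t} : Finset W) := by simp
  induction l generalizing pre l' with
  | nil =>
    cases l' with
    | nil =>
      refine .next_move (q' := CmpState.back true) (mv := .left) hp (by simp at hs; omega) ?_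
        (eqTest_back hr hp (by simp [Transducer.moveHead])
          (by simp [Transducer.moveHead]; omega))
      simp [act, eqTest, read_heads hmem.1 hr, read_heads hmem.2 ht]
    | cons b' l' =>
      refine .next_move (q' := CmpState.back false) (mv := .left) hp (by simp at hs; omega) ?_
        (eqTest_back hr hp (by simp [Transducer.moveHead])
          (by simp [Transducer.moveHead]; omega))
      simp [act, eqTest, read_heads hmem.1 hr, read_heads hmem.2 ht]
  | cons b l ih =>
    by_cases hb : l'.head? = some b
    · obtain ⟨m, rfl⟩ : ∃ m, l' = b :: m := by
        cases l' <;> simp_all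
      have := ih (pre ++ [b]) m (by simpa using hr) (by simpa using ht) (by simp at hs ⊢; omega)
      refine .next_move (q' := CmpState.compare) (mv := .right) hp (by simp at hs; omega) ?_
        (by simpa [Transducer.moveHead] using this)
      simp [act, eqTest, read_heads hmem.1 hr, read_heads hmem.2 ht]
    · have hne : decide (b :: l = l') = false := by
        cases l' <;> simp_all [eq_comm]
      rw [hne]
      refine .next_move (q' := CmpState.back false) (mv := .left) hp (by simp at hs; omega) ?_
        (eqTest_back hr hp (by simp [Transducer.moveHead])
          (by simp [Transducer.moveHead]; omega))
      simp [act, eqTest, read_heads hmem.1 hr, read_heads hmem.2 ht, Ne.symm hb]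

end Elementary

end Frag

/-! ### Programs on registers -/

/-- What a program sees of a configuration: the position of the input head, a number on each work
tape, and the output. -/
@[ext]
structure Mem (W : Type) where
  pos : ℕ
  reg : W → ℕ
  out : List Bool

namespace Mem

variable {W : Type}

/-- The configuration that represents a memory, with all work heads on cell `0`. -/
def conf (m : Mem W) : Conf W :=
  ⟨m.pos, fun i => tapeOf (digits (m.reg i)), fun _ => 0, m.out⟩

/-- Replace the contents of register `r`. -/
def set [DecidableEq W] (m : Mem W) (r : W) (a : ℕ) : Mem W :=
  ⟨m.pos, Function.update m.reg r a, m.out⟩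

theorem conf_set [DecidableEq W] (m : Mem W) (r : W) (a : ℕ) (R : Finset W) :
    (m.set r a).conf =
      ⟨m.pos, Function.update m.conf.tape r (tapeOf (digits a)), Frag.heads R 0, m.out⟩ := by
  simp only [conf, set, Frag.heads_zero, Conf.mk.injEq, true_and, and_true]
  funext i
  by_cases h : i = r
  · subst h; simp
  · simp [h]

theorem conf_eq [DecidableEq W] (m : Mem W) (R : Finset W) :
    m.conf = ⟨m.pos, m.conf.tape, Frag.heads R 0, m.out⟩ := by
  simp [conf, Frag.heads_zero]

end Mem

namespace Frag

variable {W E E' : Type} {x : List Bool} {B : ℕ}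

/-- On input `x` and memory `m`, the fragment is left through the exit `e` with memory `m'`. The
work space suffices for registers with contents up to `B`. -/
def Exec (F : Frag W E) (x : List Bool) (B : ℕ) (m : Mem W) (e : E) (m' : Mem W) : Prop :=
  m.pos ≤ x.length + 1 →
    m'.pos ≤ x.length + 1 ∧ F.Steps x (Nat.log 2 (B + 1) + 2) F.start m.conf e m'.conf

theorem Exec.bind [Finite E] {F : Frag W E} {G : E → Frag W E'} {e : E} {m m' m'' : Mem W}
    {e' : E'} (h : F.Exec x B m e m') (h' : (G e).Exec x B m' e' m'') :
    (F.bind G).Exec x B m e' m'' := fun hp =>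
  have h1 := h hp
  have h2 := h' h1.1
  ⟨h2.1, h1.2.bind h2.2⟩

theorem Exec.loop_false {F : Frag W Bool} {m m' : Mem W} (h : F.Exec x B m false m') :
    F.loop.Exec x B m () m' := fun hp => ⟨(h hp).1, (h hp).2.loop_false⟩

theorem Exec.loop_true {F : Frag W Bool} {m m' m'' : Mem W} (h : F.Exec x B m true m')
    (h' : F.loop.Exec x B m' () m'') : F.loop.Exec x B m () m'' := fun hp =>
  have h1 := h hp
  have h2 := h' h1.1
  ⟨h2.1, h1.2.loop_true h2.2⟩

theorem exec_single {mv : Move} {out : Option Bool} {g : InSym → E} {m : Mem W} :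
    (single mv out g).Exec x B m (g (Transducer.inSym x m.pos))
      ⟨min (Transducer.moveHead mv m.pos) (x.length + 1), m.reg, m.out ++ out.toList⟩ := by
  intro _
  refine ⟨min_le_right _ _, ?_⟩
  have := Steps.exit (F := single mv out g) (x := x) (s := Nat.log 2 (B + 1) + 2) (q := ())
    (c := m.conf) (e := g (Transducer.inSym x m.pos)) (fun i => by simp [Mem.conf]) rfl
  convert this using 1
  simp [Mem.conf, Conf.apply, act, single, Transducer.moveHead]

theorem exec_pure {e : E} {m : Mem W} : (pure e).Exec x B m e m := fun hp => by
  have hm : min (Transducer.moveHead .stay m.pos) (x.length + 1) = m.pos := min_eq_left hp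
  have := exec_single (mv := .stay) (out := none) (g := fun _ => e) (x := x) (B := B) (m := m) hp
  rwa [hm, Option.toList_none, List.append_nil] at this

theorem exec_emit {b : Bool} {m : Mem W} :
    (emit b).Exec x B m () ⟨m.pos, m.reg, m.out ++ [b]⟩ := fun hp => by
  have hm : min (Transducer.moveHead .stay m.pos) (x.length + 1) = m.pos := min_eq_left hp
  have := exec_single (mv := .stay) (out := some b) (g := fun _ => ()) (x := x) (B := B) (m := m) hp
  rwa [hm] at this

theorem exec_moveRight {m : Mem W} (h : m.pos + 1 ≤ x.length + 1) :
    moveRight.Exec x B m () ⟨m.pos + 1, m.reg, m.out⟩ := fun hp => by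
  have hm : min (Transducer.moveHead .right m.pos) (x.length + 1) = m.pos + 1 := min_eq_left h
  have := exec_single (mv := .right) (out := none) (g := fun _ => ()) (x := x) (B := B) (m := m) hp
  rwa [hm, Option.toList_none, List.append_nil] at this

section Registers

variable [DecidableEq W]

theorem exec_inc {r : W} {m : Mem W} (h : m.reg r ≤ B) :
    (inc r).Exec x B m () (m.set r (m.reg r + 1)) := by
  intro hp
  refine ⟨hp, ?_⟩
  rw [m.conf_eq {r}, m.conf_set r _ {r}]
  refine Steps.next_move (F := inc r) (q' := ScanState.carry) (mv := .right) hp (by omega) rfl ?_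
  exact inc_carry [] (digits (m.reg r)) rfl hp (by have := length_digits_le h; simp; omega)

theorem exec_clear {r : W} {m : Mem W} (h : m.reg r ≤ B) :
    (clear r).Exec x B m () (m.set r 0) := by
  intro hp
  refine ⟨hp, ?_⟩
  rw [m.conf_eq {r}, m.conf_set r _ {r}]
  refine Steps.next_move (F := clear r) (q' := ScanState.carry) (mv := .right) hp (by omega) rfl ?_
  exact clear_scan [] (digits (m.reg r)) rfl hp (by have := length_digits_le h; simp; omega)

theorem exec_eqTest {r t : W} {m : Mem W} (h : m.reg r ≤ B) :
    (eqTest r t).Exec x B m (decide (m.reg r = m.reg t)) m := by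
  intro hp
  refine ⟨hp, ?_⟩
  rw [m.conf_eq {r, t}]
  refine Steps.next_move (F := eqTest r t) (q' := CmpState.compare) (mv := .right) hp (by omega)
    rfl ?_
  have := eqTest_compare (T := m.conf.tape) (p := m.pos) (o := m.out) (x := x)
    (s := Nat.log 2 (B + 1) + 2) [] (digits (m.reg r)) (digits (m.reg t)) rfl
    rfl hp (by have := length_digits_le h; simp; omega)
  simpa [digits_injective.eq_iff, Transducer.moveHead] using this

/-- Run `body` with register `r` set to `0, 1, …` until `r` equals register `b`; `r` is `0` before
and after. -/
def forLoop (r b : W) (body : Frag W Unit) : Frag W Unit :=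
  ((eqTest r b).bind fun c => bif c then pure false else
    body.bind fun _ => (inc r).bind fun _ => pure true).loop.bind fun _ => clear r

/-- Correctness of `forLoop`; `A t` is the memory after `t` rounds, up to the register `r`. -/
theorem exec_forLoop {r b : W} {body : Frag W Unit} {z : ℕ} (A : ℕ → Mem W) (hr : b ≠ r)
    (hz : z ≤ B) (h0 : (A 0).reg r = 0) (h1 : (A z).reg r = 0) (hb : ∀ t ≤ z, (A t).reg b = z)
    (hbody : ∀ t < z, body.Exec x B ((A t).set r t) () ((A (t + 1)).set r t)) :
    (forLoop r b body).Exec x B (A 0) () (A z) := by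
  have set_reg : ∀ (m : Mem W) a, (m.set r a).reg r = a := fun m a => by simp [Mem.set]
  have set_set : ∀ (m : Mem W) a a', (m.set r a).set r a' = m.set r a' := fun m a a' => by
    simp [Mem.set]
  have set_zero : ∀ m : Mem W, m.reg r = 0 → m.set r 0 = m := fun m h => by
    ext i
    · rfl
    · by_cases hi : i = r
      · subst hi; simp [Mem.set, h]
      · simp [Mem.set, hi]
    · rfl
  have test : ∀ t ≤ z, (eqTest r b).Exec x B ((A t).set r t) (decide (t = z)) ((A t).set r t) := by
    intro t ht
    have := exec_eqTest (x := x) (B := B) (r := r) (t := b) (m := (A t).set r t)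
      (by rw [set_reg]; omega)
    rw [set_reg] at this
    rwa [show ((A t).set r t).reg b = z by simp [Mem.set, hr, hb t ht]] at this
  -- Induction on the number `d` of rounds that remain.
  have key : ∀ d t, t + d = z → (((eqTest r b).bind fun c => bif c then pure false else
      body.bind fun _ => (inc r).bind fun _ => pure true).loop).Exec x B
      ((A t).set r t) () ((A z).set r z) := by
    intro d
    induction d with
    | zero =>
      rintro t rfl
      refine .loop_false (.bind (test t le_rfl) ?_)
      simpa using exec_pure
    | succ d ih =>
      intro t ht
      refine .loop_true (.bind (test t (by omega)) (m'' := (A (t + 1)).set r (t + 1)) ?_)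
        (ih (t + 1) (by omega))
      rw [decide_eq_false (by omega)]
      refine .bind (hbody t (by omega)) (.bind (exec_inc ?_) ?_)
      · rw [set_reg]; omega
      · rw [set_set, set_reg]; exact exec_pure
  have h2 := key z 0 (by omega)
  rw [set_zero _ h0] at h2
  refine .bind h2 ?_
  have h3 := exec_clear (x := x) (B := B) (r := r) (m := (A z).set r z) (by rw [set_reg]; omega)
  rwa [set_set, set_zero _ h1] at h3

end Registers

/-- Move the input head back to the left end marker. -/
def rewind : Frag W Unit :=
  (single .left none fun a => match a with
    | .leftEnd => false
    | _ => true).loop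

theorem inSym_succ_ne {p : ℕ} : Transducer.inSym x (p + 1) ≠ .leftEnd := by
  unfold Transducer.inSym; split <;> simp_all; split <;> simp

theorem exec_rewind {m : Mem W} : rewind.Exec x B m () ⟨0, m.reg, m.out⟩ := by
  obtain ⟨p, ρ, o⟩ := m
  induction p with
  | zero =>
    refine .loop_false ?_
    have := exec_single (x := x) (B := B) (mv := .left) (out := none) (g := fun a => match a with
      | .leftEnd => false
      | _ => true) (m := (⟨0, ρ, o⟩ : Mem W))
    simpa [Transducer.moveHead, Transducer.inSym] using this
  | succ p ih =>
    intro hp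
    simp only at hp
    refine Exec.loop_true (m' := ⟨p, ρ, o⟩) ?_ ih hp
    have := exec_single (x := x) (B := B) (mv := .left) (out := none) (g := fun a => match a with
      | .leftEnd => false
      | _ => true) (m := (⟨p + 1, ρ, o⟩ : Mem W))
    have hm : min (Transducer.moveHead .left (p + 1)) (x.length + 1) = p :=
      min_eq_left (by simp [Transducer.moveHead]; omega)
    simp only [hm] at this
    split at this
    · exact absurd ‹_› inSym_succ_ne
    · simpa using this

/-- The bit read by the input head. -/
def symBit : InSym → Bool
  | .bit b => b
  | _ => false

/-- Read a number in unary at the input head, and run `body` once for each unit. -/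
def unaryLoop (body : Frag W Unit) : Frag W Unit :=
  ((single .right none symBit).bind fun b => bif b then body.bind fun _ => pure true
    else pure false).loop

/-- Correctness of `unaryLoop`; `A t` are the registers after `t` rounds. -/
theorem exec_unaryLoop {body : Frag W Unit} {pre post : List Bool} {z : ℕ} {o : List Bool}
    (hx : x = pre ++ (encUnary z ++ post)) (A : ℕ → W → ℕ)
    (hbody : ∀ t < z, ∀ p, body.Exec x B ⟨p, A t, o⟩ () ⟨p, A (t + 1), o⟩) :
    (unaryLoop body).Exec x B ⟨pre.length + 1, A 0, o⟩ ()
      ⟨(pre ++ encUnary z).length + 1, A z, o⟩ := by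
  have hlen : x.length = pre.length + (z + 1) + post.length := by
    rw [hx]; simp [encUnary]; ring
  have read : ∀ t ≤ z, ∀ ρ : W → ℕ, (single .right none symBit).Exec x B
      ⟨pre.length + t + 1, ρ, o⟩ (decide (t < z)) ⟨pre.length + t + 2, ρ, o⟩ := by
    intro t ht ρ
    have := exec_single (x := x) (B := B) (mv := .right) (out := none) (g := symBit)
      (m := (⟨pre.length + t + 1, ρ, o⟩ : Mem W))
    have hm : min (Transducer.moveHead .right (pre.length + t + 1)) (x.length + 1) =
      pre.length + t + 2 := min_eq_left (by rw [hlen]; simp [Transducer.moveHead]; omega)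
    have hbit : x[pre.length + t]? = some (decide (t < z)) := by
      rw [hx, List.getElem?_append_right (by omega), Nat.add_sub_cancel_left,
        List.getElem?_append_left (by simp [encUnary]; omega), encUnary]
      by_cases h : t < z
      · rw [List.getElem?_append_left (by simpa using h)]
        simp [h]
      · obtain rfl : t = z := by omega
        simp
    simpa [hm, Transducer.inSym, hbit, symBit] using this
  have key : ∀ d t, t + d = z → (unaryLoop body).Exec x B ⟨pre.length + t + 1, A t, o⟩ ()
      ⟨pre.length + z + 2, A z, o⟩ := by
    intro d
    induction d with
    | zero =>
      rintro t rfl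
      refine .loop_false (.bind (read t le_rfl _) ?_)
      simpa using exec_pure
    | succ d ih =>
      intro t ht
      have h := ih (t + 1) (by omega)
      rw [show pre.length + (t + 1) + 1 = pre.length + t + 2 by ring] at h
      refine .loop_true (.bind (read t (by omega) _) ?_) h
      rw [decide_eq_true (by omega)]
      exact .bind (hbody t (by omega) _) exec_pure
  simpa [encUnary, Nat.add_assoc] using key z 0 (by omega)

/-! ### Commands that emit, tests, and moves of the input head -/

/-- The command emits `l`; everything else is as before. -/
def Emits (F : Frag W Unit) (x : List Bool) (B : ℕ) (ρ : W → ℕ) (l : List Bool) : Prop :=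
  ∀ o, F.Exec x B ⟨0, ρ, o⟩ () ⟨0, ρ, o ++ l⟩

/-- The test has outcome `b`; everything is as before. -/
def Tests (F : Frag W Bool) (x : List Bool) (B : ℕ) (ρ : W → ℕ) (b : Bool) : Prop :=
  ∀ o, F.Exec x B ⟨0, ρ, o⟩ b ⟨0, ρ, o⟩

/-- The command moves the input head by `d` cells to the right. -/
def Moves (F : Frag W Unit) (x : List Bool) (B : ℕ) (ρ : W → ℕ) (d : ℕ) : Prop :=
  ∀ p o, p + d ≤ x.length + 1 → F.Exec x B ⟨p, ρ, o⟩ () ⟨p + d, ρ, o⟩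

/-- Two commands in sequence. -/
def seq (F G : Frag W Unit) : Frag W Unit := F.bind fun _ => G

/-- Short-circuit conjunction: the second test is not run, and need not make sense, if the first one
fails. -/
def and (S T : Frag W Bool) : Frag W Bool := S.bind fun b => bif b then T else pure false

/-- Short-circuit disjunction. -/
def or (S T : Frag W Bool) : Frag W Bool := S.bind fun b => bif b then pure true else T

/-- Negation of a test. -/
def not (S : Frag W Bool) : Frag W Bool := S.bind fun b => pure !b

/-- Emit the outcome of a test. -/
def emitTest (S : Frag W Bool) : Frag W Unit := S.bind emit

/-- Move the input head by the command `F`, read a bit, and move the head back. -/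
def bitAt (F : Frag W Unit) : Frag W Bool :=
  F.bind fun _ => (single .stay none symBit).bind fun b => rewind.bind fun _ => pure b

variable {ρ : W → ℕ}

theorem Emits.seq {F G : Frag W Unit} {l l' : List Bool} (hF : F.Emits x B ρ l)
    (hG : G.Emits x B ρ l') : (F.seq G).Emits x B ρ (l ++ l') := fun o => by
  rw [← List.append_assoc]
  exact (hF o).bind (hG _)

theorem emits_emit (b : Bool) : (emit b).Emits x B ρ [b] := fun _ => exec_emit

theorem Tests.emitTest {S : Frag W Bool} {b : Bool} (h : S.Tests x B ρ b) :
    S.emitTest.Emits x B ρ [b] := fun o => (h o).bind exec_emit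

theorem Tests.and {S T : Frag W Bool} {b c : Bool} (hS : S.Tests x B ρ b)
    (hT : b = true → T.Tests x B ρ c) : (S.and T).Tests x B ρ (b && c) := fun o => by
  cases b
  · exact (hS o).bind exec_pure
  · exact (hS o).bind (hT rfl o)

theorem Tests.or {S T : Frag W Bool} {b c : Bool} (hS : S.Tests x B ρ b)
    (hT : T.Tests x B ρ c) : (S.or T).Tests x B ρ (b || c) := fun o => by
  cases b
  · exact (hS o).bind (hT o)
  · exact (hS o).bind exec_pure

theorem Tests.not {S : Frag W Bool} {b : Bool} (hS : S.Tests x B ρ b) :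
    S.not.Tests x B ρ (!b) := fun o => (hS o).bind exec_pure

theorem Moves.seq {F G : Frag W Unit} {d d' : ℕ} (hF : F.Moves x B ρ d)
    (hG : G.Moves x B ρ d') : (F.seq G).Moves x B ρ (d + d') := fun p o hp => by
  rw [← Nat.add_assoc] at hp ⊢
  exact (hF p o (by omega)).bind (hG _ _ hp)

theorem moves_moveRight : moveRight.Moves x B ρ 1 := fun _ _ hp => exec_moveRight hp

/-- Cell `0` of the input tape holds the left end marker, so the input bit with index `d` is on
cell `d + 1`. -/
theorem Moves.bitAt {F : Frag W Unit} {d : ℕ} {b : Bool} (hF : F.Moves x B ρ (d + 1))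
    (hb : x[d]? = some b) : F.bitAt.Tests x B ρ b := fun o => by
  have hd : d < x.length := by
    by_contra h
    rw [List.getElem?_eq_none (by omega)] at hb
    cases hb
  refine (hF 0 o (by omega)).bind (Exec.bind (e := b) (m' := ⟨0 + (d + 1), ρ, o⟩) ?_
    (exec_rewind.bind exec_pure))
  have := exec_single (x := x) (B := B) (mv := .stay) (out := none) (g := symBit)
      (m := (⟨d + 1, ρ, o⟩ : Mem W))
  have hm : min (Transducer.moveHead .stay (d + 1)) (x.length + 1) = d + 1 :=
    min_eq_left (by simp [Transducer.moveHead]; omega)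
  simpa [hm, Transducer.inSym, hb, symBit] using this

variable [DecidableEq W]

theorem tests_eqTest {r t : W} (h : ρ r ≤ B) :
    (eqTest r t).Tests x B ρ (decide (ρ r = ρ t)) := fun o =>
  exec_eqTest (m := ⟨0, ρ, o⟩) h

theorem Emits.forLoop {r b : W} {body : Frag W Unit} {l : ℕ → List Bool} (hrb : b ≠ r)
    (hb : ρ b ≤ B) (hr : ρ r = 0)
    (h : ∀ t < ρ b, body.Emits x B (Function.update ρ r t) (l t)) :
    (forLoop r b body).Emits x B ρ ((List.range (ρ b)).flatMap l) := fun o => by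
  have := exec_forLoop (x := x) (B := B) (r := r) (b := b) (body := body) (z := ρ b)
    (fun t => ⟨0, ρ, o ++ (List.range t).flatMap l⟩) hrb hb hr hr (fun _ _ => rfl)
    (fun t ht => by
      simp only [List.range_succ, List.flatMap_append, List.flatMap_singleton,
        ← List.append_assoc]
      exact h t ht _)
  simpa using this

theorem Moves.forLoop {r b : W} {body : Frag W Unit} {d : ℕ} (hrb : b ≠ r)
    (hb : ρ b ≤ B) (hr : ρ r = 0)
    (h : ∀ t < ρ b, body.Moves x B (Function.update ρ r t) d) :
    (forLoop r b body).Moves x B ρ (ρ b * d) := fun p o hp => by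
  have := exec_forLoop (x := x) (B := B) (r := r) (b := b) (body := body) (z := ρ b)
    (fun t => ⟨p + t * d, ρ, o⟩) hrb hb hr hr (fun _ _ => rfl)
    (fun t ht => by
      have : (t + 1) * d ≤ ρ b * d := Nat.mul_le_mul_right d ht
      rw [Nat.succ_mul] at this ⊢
      rw [← Nat.add_assoc]
      exact h t ht _ _ (by simp only; omega))
  simpa using this

end Frag

open Frag

/-! ### The machine of the reduction -/

/-- The registers: the numbers `k`, `k + 1`, `n`, `n + 1`, `n + 2`, the numbers of two blocks
(`i`, `j`) and of a vertex in each of them (`v`, `w`), two auxiliary loop counters and a counter of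
initial vertices. -/
inductive Reg
  | K | K1 | N | N1 | N2 | i | v | j | w | a | b | c
  deriving DecidableEq

instance : Finite Reg :=
  Finite.of_surjective
    (![.K, .K1, .N, .N1, .N2, .i, .v, .j, .w, .a, .b, .c] : Fin 12 → Reg) (by
      rintro ⟨⟩
      exacts [⟨0, rfl⟩, ⟨1, rfl⟩, ⟨2, rfl⟩, ⟨3, rfl⟩, ⟨4, rfl⟩, ⟨5, rfl⟩, ⟨6, rfl⟩, ⟨7, rfl⟩,
        ⟨8, rfl⟩, ⟨9, rfl⟩, ⟨10, rfl⟩, ⟨11, rfl⟩])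

/-- Read the numbers `k` and `n` at the beginning of the input. -/
def readHeader : Frag Reg Unit :=
  moveRight.bind fun _ => (unaryLoop ((inc .K).seq (inc .K1))).bind fun _ =>
  (inc .K1).bind fun _ => (unaryLoop ((inc .N).seq ((inc .N1).seq (inc .N2)))).bind fun _ =>
  (inc .N1).bind fun _ => (inc .N2).bind fun _ => (inc .N2).bind fun _ => rewind

/-- The part of the input after the header, the adjacency matrix and the two characteristic
vectors, is treated as a matrix with `n + 2` rows of length `n`; read its entry in row `r` and
column `s`. The header has `(k + 1) + (n + 1)` bits, so the matrix begins on cell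
`(k + 1) + (n + 2)` of the input tape. -/
def entryTest (r s : Reg) : Frag Reg Bool :=
  bitAt ((forLoop .a .K1 moveRight).seq ((forLoop .a .N2 moveRight).seq
    ((forLoop .a r (forLoop .b .N moveRight)).seq (forLoop .a s moveRight))))

/-- Test whether the vertex number in `V` belongs to the copy of the original graph. -/
def copyTest (V : Reg) : Frag Reg Bool := (eqTest V .N).not.and (eqTest V .N1).not

/-- Test the edges between the vertex `V` of block `I` and the vertex `W` of block `J` for which the
latter is a parking vertex or a switch vertex. -/
def halfAdjTest (I V J W : Reg) : Frag Reg Bool :=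
  ((eqTest I .K).not.and ((copyTest V).and ((eqTest I J).and
    ((eqTest W .N).and (entryTest .N1 V))))).or
  (((eqTest I .K).not.and ((eqTest V .N).and ((eqTest J .K).and (eqTest W .N)))).or
  (((eqTest I .K).not.and ((copyTest V).and ((eqTest J .K).and
    ((eqTest W .N1).and (entryTest .N1 V).not)))).or
  ((eqTest I .K).and ((eqTest V .N).and ((eqTest J .K).and (eqTest W .N1))))))

/-- Test whether the vertex `v` of block `i` and the vertex `w` of block `j` are adjacent. -/
def adjTest : Frag Reg Bool :=
  ((eqTest .i .K).not.and ((eqTest .j .K).not.and ((copyTest .v).and ((copyTest .w).and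
    (((eqTest .i .j).not.and (eqTest .v .w)).or (entryTest .v .w)))))).or
  ((halfAdjTest .i .v .j .w).or (halfAdjTest .j .w .i .v))

/-- Test whether there are exactly `i` initial vertices before the vertex `v`. -/
def countTest : Frag Reg Bool :=
  (forLoop .j .v ((entryTest .N .j).bind fun b => bif b then inc .c else pure ())).bind fun _ =>
  (eqTest .c .i).bind fun b => (clear .c).bind fun _ => pure b

/-- Test whether the vertex `v` of block `i` is an initial vertex. -/
def startTest : Frag Reg Bool :=
  ((eqTest .i .K).and (eqTest .v .N)).or
  ((eqTest .i .K).not.and ((copyTest .v).and ((entryTest .N .v).and countTest)))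

/-- Test whether the vertex `v` of block `i` is a final vertex. -/
def goalTest : Frag Reg Bool :=
  ((eqTest .i .K).not.and (eqTest .v .N)).or ((eqTest .i .K).and (eqTest .v .N1))

/-- Run a command for all vertices, the current one being vertex `V` of block `I`. -/
def forVertices (I V : Reg) (F : Frag Reg Unit) : Frag Reg Unit :=
  forLoop I .K1 (forLoop V .N2 F)

/-- Write the encoding of the new instance, once the registers hold the numbers `k` and `n`. -/
def writeInstance : Frag Reg Unit :=
  ((forLoop .i .K1 (emit true)).seq (emit false)).seq
  (((forVertices .i .v (emit true)).seq (emit false)).seq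
  ((forVertices .i .v (forVertices .j .w adjTest.emitTest)).seq
  ((forVertices .i .v (forLoop .j .K1 (eqTest .i .j).emitTest)).seq
  ((forVertices .i .v startTest.emitTest).seq
  (forVertices .i .v goalTest.emitTest)))))

/-- The machine of the reduction. -/
def reduction : Frag Reg Unit := readHeader.bind fun _ => writeInstance

/-- The contents of the registers while the output is written. -/
def env (k n i v j w c : ℕ) : Reg → ℕ
  | .K => k
  | .K1 => k + 1
  | .N => n
  | .N1 => n + 1
  | .N2 => n + 2
  | .i => i
  | .v => v
  | .j => j
  | .w => w
  | .a => 0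
  | .b => 0
  | .c => c

section Env

variable {k n i v j w c t : ℕ}

theorem update_env_i : Function.update (env k n i v j w c) .i t = env k n t v j w c := by
  funext r; cases r <;> rfl

theorem update_env_v : Function.update (env k n i v j w c) .v t = env k n i t j w c := by
  funext r; cases r <;> rfl

theorem update_env_j : Function.update (env k n i v j w c) .j t = env k n i v t w c := by
  funext r; cases r <;> rfl

theorem update_env_w : Function.update (env k n i v j w c) .w t = env k n i v j t c := by
  funext r; cases r <;> rfl

theorem update_env_c : Function.update (env k n i v j w c) .c t = env k n i v j w t := by
  funext r; cases r <;> rfl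

end Env

/-! ### Correctness of the tests -/

/-- The entry in row `r` and column `s` of the part of the encoding after the header. -/
noncomputable def TSInst.entry (A : TSInst) (r s : ℕ) : Bool :=
  (A.encode[A.k + 1 + (A.n + 1) + (r * A.n + s)]?).getD false

theorem TSInst.length_encode (A : TSInst) :
    A.encode.length = A.k + 1 + (A.n + 1) + (A.n + 2) * A.n := by
  simp only [encode, List.length_append, length_encRel, length_encSet, encUnary,
    List.length_replicate, List.length_singleton]
  ring

theorem TSInst.getElem?_encode (A : TSInst) (d : ℕ) :
    A.encode[A.k + 1 + (A.n + 1) + d]? =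
      (encRel A.G.Adj ++ (encSet A.start ++ encSet A.goal))[d]? := by
  have hk : (encUnary A.k).length = A.k + 1 := by simp [encUnary]
  have hn : (encUnary A.n).length = A.n + 1 := by simp [encUnary]
  rw [encode, List.getElem?_append_right (by omega), List.getElem?_append_right (by omega)]
  congr 1; omega

theorem encRel_getElem? {a b : ℕ} (R : Fin a → Fin b → Prop) [∀ i j, Decidable (R i j)]
    (i : Fin a) (j : Fin b) : (encRel R)[(i : ℕ) * b + j]? = some (decide (R i j)) := by
  have hp : ∀ (i : Fin a) (j : Fin b) (h : (i : ℕ) * b + j < a * b),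
      (⟨i * b + j, h⟩ : Fin (a * b)).divNat = i ∧ (⟨i * b + j, h⟩ : Fin (a * b)).modNat = j := by
    intro i j h
    have h2 := finProdFinEquiv.symm_apply_apply (i, j)
    rwa [show finProdFinEquiv (i, j) = ⟨i * b + j, h⟩ from
      Fin.ext (by simp [add_comm, mul_comm]), finProdFinEquiv_symm_apply, Prod.mk.injEq] at h2
  have hlt : (i : ℕ) * b + j < a * b := by
    have := (finProdFinEquiv (i, j)).2
    simp only [finProdFinEquiv_apply_val] at this
    rw [mul_comm, add_comm]; exact this
  have h1 : encRel R = List.ofFn (fun p : Fin (a * b) => decide (R p.divNat p.modNat)) := by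
    rw [List.ofFn_mul, encRel]
    simp only [hp]
    congr 2; funext i; congr 1; funext j; congr
  rw [h1, List.getElem?_ofFn, dif_pos hlt, (hp i j hlt).1, (hp i j hlt).2]

theorem TSInst.entry_adj (A : TSInst) (v w : Fin A.n) [Decidable (A.G.Adj v w)] :
    A.entry v w = decide (A.G.Adj v w) := by
  classical
  have hlt : (v : ℕ) * A.n + w < A.n * A.n := by
    have := (finProdFinEquiv (v, w)).2
    simp only [finProdFinEquiv_apply_val] at this
    rw [mul_comm, add_comm]; exact this
  rw [entry, A.getElem?_encode, List.getElem?_append_left (by rwa [length_encRel]),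
    encRel_getElem?]
  simp

theorem TSInst.entry_start (A : TSInst) (v : Fin A.n) :
    A.entry A.n v = decide (v ∈ A.start) := by
  rw [entry, A.getElem?_encode, List.getElem?_append_right (by rw [length_encRel]; omega),
    length_encRel, Nat.add_sub_cancel_left,
    List.getElem?_append_left (by rw [length_encSet]; exact v.2), encSet, List.getElem?_ofFn,
    dif_pos v.2]
  simp

theorem TSInst.entry_goal (A : TSInst) (v : Fin A.n) :
    A.entry (A.n + 1) v = decide (v ∈ A.goal) := by
  rw [entry, A.getElem?_encode, List.getElem?_append_right (by rw [length_encRel]; grind),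
    length_encRel, show (A.n + 1) * A.n + v - A.n * A.n = A.n + v by
      rw [Nat.succ_mul, Nat.add_assoc, Nat.add_sub_cancel_left],
    List.getElem?_append_right (by rw [length_encSet]; omega), length_encSet,
    Nat.add_sub_cancel_left, encSet, List.getElem?_ofFn, dif_pos v.2]
  simp

theorem TSInst.le_length_encode (A : TSInst) :
    A.k + 1 ≤ A.encode.length ∧ A.n + 2 ≤ A.encode.length := by
  rw [A.length_encode]; constructor <;> omega

section Tests

variable (A : TSInst)

/-- The value of `copyTest`. -/
def copyVal (v : ℕ) : Bool := !decide (v = A.n) && !decide (v = A.n + 1)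

/-- The value of `halfAdjTest`. -/
noncomputable def halfAdjVal (i v j w : ℕ) : Bool :=
  (!decide (i = A.k) && (copyVal A v && (decide (i = j) &&
    (decide (w = A.n) && A.entry (A.n + 1) v)))) ||
  ((!decide (i = A.k) && (decide (v = A.n) && (decide (j = A.k) && decide (w = A.n)))) ||
  ((!decide (i = A.k) && (copyVal A v && (decide (j = A.k) &&
    (decide (w = A.n + 1) && !A.entry (A.n + 1) v)))) ||
  (decide (i = A.k) && (decide (v = A.n) && (decide (j = A.k) && decide (w = A.n + 1))))))

/-- The value of `adjTest`. -/
noncomputable def adjVal (i v j w : ℕ) : Bool :=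
  (!decide (i = A.k) && (!decide (j = A.k) && (copyVal A v && (copyVal A w &&
    ((!decide (i = j) && decide (v = w)) || A.entry v w))))) ||
  (halfAdjVal A i v j w || halfAdjVal A j w i v)

/-- The value of `startTest`. -/
noncomputable def startVal (i v : ℕ) : Bool :=
  (decide (i = A.k) && decide (v = A.n)) ||
  (!decide (i = A.k) && (copyVal A v && (A.entry A.n v &&
    decide (Nat.count (fun u => A.entry A.n u = true) v = i))))

/-- The value of `goalTest`. -/
def goalVal (i v : ℕ) : Bool :=
  (!decide (i = A.k) && decide (v = A.n)) || (decide (i = A.k) && decide (v = A.n + 1))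

variable {A} {i v j w c : ℕ}

theorem lt_of_copyVal (hv : v < A.n + 2) (h : copyVal A v = true) : v < A.n := by
  simp [copyVal] at h; omega

theorem tests_entryTest {r s : Reg} (hra : r ≠ .a) (hsa : s ≠ .a)
    (hr : env A.k A.n i v j w c r < A.n + 2) (hs : env A.k A.n i v j w c s < A.n) :
    (entryTest r s).Tests A.encode A.encode.length (env A.k A.n i v j w c)
      (A.entry (env A.k A.n i v j w c r) (env A.k A.n i v j w c s)) := by
  obtain ⟨hB1, hB2⟩ := A.le_length_encode
  set ρ := env A.k A.n i v j w c with hρ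
  have hlt : ρ r * A.n + ρ s < (A.n + 2) * A.n := by
    have := Nat.mul_le_mul_right A.n (Nat.succ_le_of_lt hr)
    rw [Nat.succ_mul] at this
    omega
  have h1 : (forLoop .a .K1 moveRight).Moves A.encode A.encode.length ρ ((A.k + 1) * 1) :=
    Moves.forLoop (by decide) hB1 rfl fun _ _ => moves_moveRight
  have h2 : (forLoop .a .N2 moveRight).Moves A.encode A.encode.length ρ ((A.n + 2) * 1) :=
    Moves.forLoop (by decide) hB2 rfl fun _ _ => moves_moveRight
  have h3 : (forLoop .a r (forLoop .b .N moveRight)).Moves A.encode A.encode.length ρ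
      (ρ r * (A.n * 1)) :=
    Moves.forLoop hra (by omega) rfl fun t _ =>
      Moves.forLoop (ρ := Function.update ρ .a t) (b := .N) (by decide)
        (show A.n ≤ _ by omega) rfl fun _ _ => moves_moveRight
  have h4 : (forLoop .a s moveRight).Moves A.encode A.encode.length ρ (ρ s * 1) :=
    Moves.forLoop hsa (by omega) rfl fun _ _ => moves_moveRight
  refine Moves.bitAt (d := A.k + 1 + (A.n + 1) + (ρ r * A.n + ρ s)) ?_ ?_
  · have := h1.seq (h2.seq (h3.seq h4))
    convert this using 1
    ring
  · rw [TSInst.entry, List.getElem?_eq_getElem (by rw [A.length_encode]; omega)]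
    rfl

theorem tests_copyTest {r : Reg} (hr : env A.k A.n i v j w c r < A.n + 2) :
    (copyTest r).Tests A.encode A.encode.length (env A.k A.n i v j w c)
      (copyVal A (env A.k A.n i v j w c r)) := by
  obtain ⟨hB1, hB2⟩ := A.le_length_encode
  have h : env A.k A.n i v j w c r ≤ A.encode.length := by omega
  exact (tests_eqTest h).not.and fun _ => (tests_eqTest h).not

theorem tests_halfAdjTest {I V J W : Reg} (hVa : V ≠ .a)
    (hI : env A.k A.n i v j w c I < A.k + 1) (hV : env A.k A.n i v j w c V < A.n + 2)
    (hJ : env A.k A.n i v j w c J < A.k + 1) (hW : env A.k A.n i v j w c W < A.n + 2) :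
    (halfAdjTest I V J W).Tests A.encode A.encode.length (env A.k A.n i v j w c)
      (halfAdjVal A (env A.k A.n i v j w c I) (env A.k A.n i v j w c V)
        (env A.k A.n i v j w c J) (env A.k A.n i v j w c W)) := by
  obtain ⟨hB1, hB2⟩ := A.le_length_encode
  have hI' := hI.le.trans hB1
  have hV' := hV.le.trans hB2
  have hJ' := hJ.le.trans hB1
  have hW' := hW.le.trans hB2
  refine Tests.or ?_ (.or ?_ (.or ?_ ?_))
  · exact (tests_eqTest hI').not.and fun _ => (tests_copyTest hV).and fun hc =>
      (tests_eqTest hI').and fun _ => (tests_eqTest hW').and fun _ =>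
      tests_entryTest (r := .N1) (by decide) hVa (Nat.lt_succ_self _) (lt_of_copyVal hV hc)
  · exact (tests_eqTest hI').not.and fun _ => (tests_eqTest hV').and fun _ =>
      (tests_eqTest hJ').and fun _ => tests_eqTest hW'
  · exact (tests_eqTest hI').not.and fun _ => (tests_copyTest hV).and fun hc =>
      (tests_eqTest hJ').and fun _ => (tests_eqTest hW').and fun _ =>
      (tests_entryTest (r := .N1) (by decide) hVa (Nat.lt_succ_self _) (lt_of_copyVal hV hc)).not
  · exact (tests_eqTest hI').and fun _ => (tests_eqTest hV').and fun _ =>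
      (tests_eqTest hJ').and fun _ => tests_eqTest hW'

theorem tests_adjTest (hi : i < A.k + 1) (hv : v < A.n + 2) (hj : j < A.k + 1)
    (hw : w < A.n + 2) : adjTest.Tests A.encode A.encode.length (env A.k A.n i v j w c)
      (adjVal A i v j w) := by
  obtain ⟨hB1, hB2⟩ := A.le_length_encode
  have hi' := hi.le.trans hB1
  have hv' := hv.le.trans hB2
  have hj' := hj.le.trans hB1
  refine Tests.or ?_ (.or ?_ ?_)
  · exact (tests_eqTest hi').not.and fun _ => (tests_eqTest hj').not.and fun _ =>
      (tests_copyTest (r := .v) hv).and fun hcv => (tests_copyTest (r := .w) hw).and fun hcw =>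
      ((tests_eqTest hi').not.and fun _ => tests_eqTest hv').or
        (tests_entryTest (r := .v) (s := .w) (by decide) (by decide) hv (lt_of_copyVal hw hcw))
  · exact tests_halfAdjTest (I := .i) (V := .v) (J := .j) (W := .w) (by decide) hi hv hj hw
  · exact tests_halfAdjTest (I := .j) (V := .w) (J := .i) (W := .v) (by decide) hj hw hi hv

theorem tests_countTest (hv : v < A.n) :
    countTest.Tests A.encode A.encode.length (env A.k A.n i v 0 0 0)
      (decide (Nat.count (fun u => A.entry A.n u = true) v = i)) := by
  intro o
  obtain ⟨hB1, hB2⟩ := A.le_length_encode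
  have hc : Nat.count (fun u => A.entry A.n u = true) v ≤ v := Nat.count_le _
  have hloop := exec_forLoop (x := A.encode) (B := A.encode.length) (r := Reg.j) (b := .v) (z := v)
    (body := (entryTest .N .j).bind fun b => bif b then inc .c else pure ())
    (fun t => ⟨0, env A.k A.n i v 0 0 (Nat.count (fun u => A.entry A.n u = true) t), o⟩)
    (by decide) (by omega) rfl rfl (fun _ _ => rfl) (by
      intro t ht
      simp only [Mem.set, update_env_j]
      refine (tests_entryTest (r := .N) (s := .j) (by decide) (by decide)
        (show A.n < A.n + 2 by omega) (show t < A.n by omega) o).bind ?_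
      simp only [env, Nat.count_succ]
      cases A.entry A.n t
      · exact exec_pure
      · have hct : Nat.count (fun u => A.entry A.n u = true) t ≤ t := Nat.count_le _
        have := exec_inc (x := A.encode) (B := A.encode.length) (r := Reg.c)
          (m := ⟨0, env A.k A.n i v t 0 (Nat.count (fun u => A.entry A.n u = true) t), o⟩)
          (by simp only [env]; omega)
        simpa [Mem.set, update_env_c, env] using this)
  refine hloop.bind ((exec_eqTest (by simp only [env]; omega)).bind ((exec_clear ?_).bind ?_))
  · simp only [env]; omega
  · simp only [Mem.set, update_env_c]
    exact exec_pure

theorem tests_startTest (hi : i < A.k + 1) (hv : v < A.n + 2) :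
    startTest.Tests A.encode A.encode.length (env A.k A.n i v 0 0 0) (startVal A i v) := by
  obtain ⟨hB1, hB2⟩ := A.le_length_encode
  have hi' := hi.le.trans hB1
  have hv' := hv.le.trans hB2
  refine Tests.or ?_ ?_
  · exact (tests_eqTest hi').and fun _ => tests_eqTest hv'
  · exact (tests_eqTest hi').not.and fun _ => (tests_copyTest (r := .v) hv).and fun hc =>
      (tests_entryTest (r := .N) (s := .v) (by decide) (by decide) (show A.n < A.n + 2 by omega)
        (lt_of_copyVal hv hc)).and fun _ => tests_countTest (lt_of_copyVal hv hc)

theorem tests_goalTest (hi : i < A.k + 1) (hv : v < A.n + 2) :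
    goalTest.Tests A.encode A.encode.length (env A.k A.n i v 0 0 0) (goalVal A i v) := by
  obtain ⟨hB1, hB2⟩ := A.le_length_encode
  have hi' := hi.le.trans hB1
  have hv' := hv.le.trans hB2
  exact ((tests_eqTest hi').not.and fun _ => tests_eqTest hv').or
    ((tests_eqTest hi').and fun _ => tests_eqTest hv')

/-! ### The values of the tests -/

theorem adjVal_eq (x y : (Fin A.k ⊕ Fin 1) × (Fin A.n ⊕ Fin 2))
    [Decidable (gadgetAdj A.G A.goal x y)] :
    adjVal A (finSumFinEquiv x.1) (finSumFinEquiv x.2) (finSumFinEquiv y.1) (finSumFinEquiv y.2) =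
      decide (gadgetAdj A.G A.goal x y) := by
  classical
  have ne (v : Fin A.n) : (v : ℕ) ≠ A.n ∧ (v : ℕ) ≠ A.n + 1 ∧ A.n ≠ v ∧ A.n + 1 ≠ v := by
    have := v.2; omega
  have ne' (i : Fin A.k) : (i : ℕ) ≠ A.k ∧ A.k ≠ i := by
    have := i.2; omega
  obtain ⟨i | i, v | v⟩ := x <;> obtain ⟨j | j, w | w⟩ := y <;> (try fin_cases v) <;>
    (try fin_cases w) <;> rw [Bool.eq_iff_iff] <;>
    simp only [adjVal, halfAdjVal, copyVal, Bool.or_eq_true, Bool.and_eq_true, Bool.not_eq_true',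
      decide_eq_true_eq, decide_eq_false_iff_not] <;>
    simp [gadgetAdj, ne, ne', A.entry_adj, A.entry_goal, Fin.ext_iff]
  exact fun _ => eq_comm

theorem startVal_eq (x : (Fin A.k ⊕ Fin 1) × (Fin A.n ⊕ Fin 2)) :
    startVal A (finSumFinEquiv x.1) (finSumFinEquiv x.2) =
      decide (vertexEquiv A.k A.n x ∈ tokens (vertexEquiv A.k A.n) (placed A.label 0)) := by
  have ne (v : Fin A.n) : (v : ℕ) ≠ A.n ∧ (v : ℕ) ≠ A.n + 1 := by
    have := v.2; omega
  have ne' (i : Fin A.k) : (i : ℕ) ≠ A.k := by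
    have := i.2; omega
  have count (v : Fin A.n) : Nat.count (fun u => A.entry A.n u = true) v =
      (A.start.filter (· < v)).card := by
    rw [Nat.count_eq_card_filter_range, ← Finset.card_map Fin.valEmbedding]
    congr 1
    ext u
    simp only [Finset.mem_filter, Finset.mem_range, Finset.mem_map, Fin.valEmbedding_apply]
    constructor
    · rintro ⟨hu, he⟩
      refine ⟨⟨u, hu.trans v.2⟩, ⟨?_, hu⟩, rfl⟩
      have := A.entry_start ⟨u, hu.trans v.2⟩
      simpa [he] using this
    · rintro ⟨u, ⟨hu, huv⟩, rfl⟩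
      exact ⟨huv, by simp [A.entry_start, hu]⟩
  obtain ⟨i | i, v | v⟩ := x <;> (try fin_cases v) <;> rw [Bool.eq_iff_iff, decide_eq_true_iff] <;>
    simp [mem_tokens, placed, startVal, copyVal, ne, ne', A.entry_start, count, A.label_eq_iff]

theorem goalVal_eq (x : (Fin A.k ⊕ Fin 1) × (Fin A.n ⊕ Fin 2)) :
    goalVal A (finSumFinEquiv x.1) (finSumFinEquiv x.2) =
      decide (vertexEquiv A.k A.n x ∈ tokens (vertexEquiv A.k A.n) (parked A.k A.n)) := by
  have ne (v : Fin A.n) : (v : ℕ) ≠ A.n ∧ (v : ℕ) ≠ A.n + 1 := by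
    have := v.2; omega
  have ne' (i : Fin A.k) : (i : ℕ) ≠ A.k := by
    have := i.2; omega
  obtain ⟨i | i, v | v⟩ := x <;> (try fin_cases v) <;> rw [Bool.eq_iff_iff, decide_eq_true_iff] <;>
    simp [mem_tokens, parked, goalVal, ne, ne']

end Tests

/-! ### Correctness of the output -/

theorem flatten_ofFn_eq {α : Type} {m : ℕ} {F : Fin m → List α} {g : ℕ → List α}
    (h : ∀ i : Fin m, F i = g i) : (List.ofFn F).flatten = (List.range m).flatMap g := by
  rw [List.flatMap_def, ← List.map_coe_finRange_eq_range, List.map_map, List.ofFn_eq_map]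
  congr 1
  exact List.map_congr_left fun i _ => h i

/-- The concatenation over all vertices is a double loop over blocks and vertices of a block. -/
theorem flatten_ofFn_vertices {α : Type} {k n : ℕ} {F : Fin ((k + 1) * (n + 2)) → List α}
    {g : ℕ → ℕ → List α}
    (h : ∀ i v, F (vertexEquiv k n (i, v)) = g (finSumFinEquiv i) (finSumFinEquiv v)) :
    (List.ofFn F).flatten =
      (List.range (k + 1)).flatMap fun i => (List.range (n + 2)).flatMap fun v => g i v := by
  rw [List.ofFn_mul, List.flatten_flatten, List.map_ofFn]
  refine flatten_ofFn_eq fun i => flatten_ofFn_eq fun v => ?_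
  obtain ⟨i, rfl⟩ := finSumFinEquiv.surjective i
  obtain ⟨v, rfl⟩ := finSumFinEquiv.surjective v
  rw [← h]
  congr 1
  exact Fin.ext (by simp [vertexEquiv, add_comm, mul_comm])

theorem ofFn_eq_flatten {α : Type} {m : ℕ} (f : Fin m → α) :
    List.ofFn f = (List.ofFn fun i => [f i]).flatten := by
  induction m with
  | zero => simp
  | succ m ih => rw [List.ofFn_succ, ih]; simp

theorem encSet_vertices {k n : ℕ} {S : Finset (Fin ((k + 1) * (n + 2)))} {g : ℕ → ℕ → Bool}
    (h : ∀ x, g (finSumFinEquiv x.1) (finSumFinEquiv x.2) = decide (vertexEquiv k n x ∈ S)) :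
    encSet S = (List.range (k + 1)).flatMap fun i => (List.range (n + 2)).flatMap fun v =>
      [g i v] := by
  rw [encSet, ofFn_eq_flatten]
  refine flatten_ofFn_vertices fun i v => ?_
  rw [h (i, v)]

section Output

variable (A : TSInst)

theorem encUnary_eq (m : ℕ) :
    encUnary m = (List.range m).flatMap (fun _ => [true]) ++ [false] := by
  simp [encUnary, List.flatMap_def, List.map_const']

theorem encUnary_mul_eq (a b : ℕ) : encUnary (a * b) =
    (List.range a).flatMap (fun _ => (List.range b).flatMap fun _ => [true]) ++ [false] := by
  simp [encUnary, List.flatMap_def, List.map_const']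

theorem encRel_adj_eq : encRel A.toPTS.G.Adj =
    (List.range (A.k + 1)).flatMap fun i => (List.range (A.n + 2)).flatMap fun v =>
      (List.range (A.k + 1)).flatMap fun j => (List.range (A.n + 2)).flatMap fun w =>
        [adjVal A i v j w] := by
  classical
  refine flatten_ofFn_vertices fun i v => ?_
  rw [ofFn_eq_flatten]
  refine flatten_ofFn_vertices fun j w => ?_
  rw [adjVal_eq (i, v) (j, w)]
  simp [TSInst.toPTS]

theorem encRel_part_eq : encRel (fun x i => A.toPTS.part x = i) =
    (List.range (A.k + 1)).flatMap fun i => (List.range (A.n + 2)).flatMap fun _ =>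
      (List.range (A.k + 1)).flatMap fun j => [decide (i = j)] := by
  refine flatten_ofFn_vertices fun i v => ?_
  rw [ofFn_eq_flatten]
  refine flatten_ofFn_eq fun j => ?_
  have h : A.toPTS.part (vertexEquiv A.k A.n (i, v)) = finSumFinEquiv i := by
    simp [TSInst.toPTS]
  refine congrArg (fun b => [b]) (decide_eq_decide.2 ?_)
  exact (Eq.congr_left h).trans Fin.ext_iff

theorem emits_forVertices {ρ : Reg → ℕ} {I V : Reg} {F : Frag Reg Unit} {l : ℕ → ℕ → List Bool}
    {k n : ℕ} {x : List Bool} {B : ℕ} (hk : k + 1 ≤ B) (hn : n + 2 ≤ B) (hI : .K1 ≠ I)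
    (hV : .N2 ≠ V) (hVI : V ≠ I) (hNI : .N2 ≠ I) (hρk : ρ .K1 = k + 1) (hρn : ρ .N2 = n + 2)
    (hρI : ρ I = 0) (hρV : ρ V = 0)
    (h : ∀ i < k + 1, ∀ v < n + 2,
      F.Emits x B (Function.update (Function.update ρ I i) V v) (l i v)) :
    (forVertices I V F).Emits x B ρ
      ((List.range (k + 1)).flatMap fun i => (List.range (n + 2)).flatMap fun v => l i v) := by
  rw [← hρk] at hk h ⊢
  refine Emits.forLoop hI hk hρI fun i hi => ?_
  have hρ : Function.update ρ I i .N2 = n + 2 := by rw [Function.update_of_ne hNI, hρn]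
  replace h := h i hi
  rw [← hρ] at hn h ⊢
  exact Emits.forLoop hV hn (by rw [Function.update_of_ne hVI, hρV]) h

variable {A}

theorem emits_forVertices_iv {F : Frag Reg Unit} {l : ℕ → ℕ → List Bool}
    (h : ∀ i < A.k + 1, ∀ v < A.n + 2,
      F.Emits A.encode A.encode.length (env A.k A.n i v 0 0 0) (l i v)) :
    (forVertices .i .v F).Emits A.encode A.encode.length (env A.k A.n 0 0 0 0 0)
      ((List.range (A.k + 1)).flatMap fun i => (List.range (A.n + 2)).flatMap fun v => l i v) :=
  emits_forVertices A.le_length_encode.1 A.le_length_encode.2 (by decide) (by decide) (by decide)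
    (by decide) rfl rfl rfl rfl fun i hi v hv => by
      rw [update_env_i, update_env_v]; exact h i hi v hv

theorem emits_forVertices_jw {F : Frag Reg Unit} {i v : ℕ} {l : ℕ → ℕ → List Bool}
    (h : ∀ j < A.k + 1, ∀ w < A.n + 2,
      F.Emits A.encode A.encode.length (env A.k A.n i v j w 0) (l j w)) :
    (forVertices .j .w F).Emits A.encode A.encode.length (env A.k A.n i v 0 0 0)
      ((List.range (A.k + 1)).flatMap fun j => (List.range (A.n + 2)).flatMap fun w => l j w) :=
  emits_forVertices A.le_length_encode.1 A.le_length_encode.2 (by decide) (by decide) (by decide)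
    (by decide) rfl rfl rfl rfl fun i hi v hv => by
      rw [update_env_j, update_env_w]; exact h i hi v hv

theorem emits_forLoop_K1 {r : Reg} {ρ : Reg → ℕ} {F : Frag Reg Unit} {l : ℕ → List Bool}
    (hr : .K1 ≠ r) (hρ : ρ .K1 = A.k + 1) (hρr : ρ r = 0)
    (h : ∀ i < A.k + 1, F.Emits A.encode A.encode.length (Function.update ρ r i) (l i)) :
    (forLoop r .K1 F).Emits A.encode A.encode.length ρ ((List.range (A.k + 1)).flatMap l) := by
  have hB := A.le_length_encode.1
  rw [← hρ] at h hB ⊢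
  exact Emits.forLoop hr hB hρr h

theorem emits_writeInstance :
    writeInstance.Emits A.encode A.encode.length (env A.k A.n 0 0 0 0 0) A.toPTS.encode := by
  rw [PTSInst.encode, encRel_adj_eq, encRel_part_eq,
    show encSet A.toPTS.start = _ from encSet_vertices startVal_eq,
    show encSet A.toPTS.goal = _ from encSet_vertices goalVal_eq,
    show A.toPTS.n = (A.k + 1) * (A.n + 2) from rfl, show A.toPTS.k = A.k + 1 from rfl,
    encUnary_mul_eq, encUnary_eq]
  refine Emits.seq (.seq ?_ (emits_emit false)) (.seq (.seq ?_ (emits_emit false))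
    (.seq ?_ (.seq ?_ (.seq ?_ ?_))))
  · exact emits_forLoop_K1 (by decide) rfl rfl fun _ _ => emits_emit true
  · exact emits_forVertices_iv fun _ _ _ _ => emits_emit true
  · exact emits_forVertices_iv fun i hi v hv => emits_forVertices_jw fun j hj w hw =>
      (tests_adjTest hi hv hj hw).emitTest
  · refine emits_forVertices_iv fun i hi v hv => emits_forLoop_K1 (by decide) rfl rfl
      fun j hj => ?_
    rw [update_env_j]
    exact (tests_eqTest (hi.le.trans A.le_length_encode.1)).emitTest
  · exact emits_forVertices_iv fun i hi v hv => (tests_startTest hi hv).emitTest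
  · exact emits_forVertices_iv fun i hi v hv => (tests_goalTest hi hv).emitTest

/-- The registers while the header is read. -/
def headerEnv (k k1 n n1 n2 : ℕ) : Reg → ℕ
  | .K => k
  | .K1 => k1
  | .N => n
  | .N1 => n1
  | .N2 => n2
  | _ => 0

theorem exec_inc_header {x : List Bool} {B p k k1 n n1 n2 k' k1' n' n1' n2' : ℕ} {o : List Bool}
    (r : Reg) (h : headerEnv k k1 n n1 n2 r ≤ B)
    (he : Function.update (headerEnv k k1 n n1 n2) r (headerEnv k k1 n n1 n2 r + 1) =
      headerEnv k' k1' n' n1' n2') :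
    (inc r).Exec x B ⟨p, headerEnv k k1 n n1 n2, o⟩ () ⟨p, headerEnv k' k1' n' n1' n2', o⟩ := by
  rw [← he]
  exact exec_inc h

theorem exec_readHeader :
    readHeader.Exec A.encode A.encode.length ⟨0, fun _ => 0, []⟩ ()
      ⟨0, env A.k A.n 0 0 0 0 0, []⟩ := by
  obtain ⟨hB1, hB2⟩ := A.le_length_encode
  have h0 : (fun _ => 0 : Reg → ℕ) = headerEnv 0 0 0 0 0 := by funext r; cases r <;> rfl
  have h1 : env A.k A.n 0 0 0 0 0 = headerEnv A.k (A.k + 1) A.n (A.n + 1) (A.n + 2) := by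
    funext r; cases r <;> rfl
  have hx : A.encode = [] ++ (encUnary A.k ++ (encUnary A.n ++ (encRel A.G.Adj ++
    (encSet A.start ++ encSet A.goal)))) := rfl
  have hx' : A.encode = ([] ++ encUnary A.k) ++ (encUnary A.n ++ (encRel A.G.Adj ++
    (encSet A.start ++ encSet A.goal))) := by rw [hx]; simp
  have hk := exec_unaryLoop (B := A.encode.length) (o := []) (body := (inc .K).seq (inc .K1)) hx
    (fun t => headerEnv t t 0 0 0) (fun t ht p =>
      (exec_inc_header (k' := t + 1) (k1' := t) .K (show t ≤ _ by omega)
        (by funext r; cases r <;> rfl)).bind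
      (exec_inc_header .K1 (show t ≤ _ by omega) (by funext r; cases r <;> rfl)))
  have hn := exec_unaryLoop (B := A.encode.length) (o := [])
    (body := (inc .N).seq ((inc .N1).seq (inc .N2))) hx'
    (fun t => headerEnv A.k (A.k + 1) t t t) (fun t ht p =>
      (exec_inc_header (n' := t + 1) (n1' := t) (n2' := t) .N (show t ≤ _ by omega)
        (by funext r; cases r <;> rfl)).bind
      ((exec_inc_header (n' := t + 1) (n1' := t + 1) (n2' := t) .N1 (show t ≤ _ by omega)
        (by funext r; cases r <;> rfl)).bind
      (exec_inc_header .N2 (show t ≤ _ by omega) (by funext r; cases r <;> rfl))))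
  rw [h0, h1]
  refine (exec_moveRight (by simp)).bind (hk.bind ((exec_inc_header .K1 (show A.k ≤ _ by omega)
    (by funext r; cases r <;> rfl)).bind (hn.bind
    ((exec_inc_header (n' := A.n) (n1' := A.n + 1) (n2' := A.n) .N1 (show A.n ≤ _ by omega)
      (by funext r; cases r <;> rfl)).bind
    ((exec_inc_header (n' := A.n) (n1' := A.n + 1) (n2' := A.n + 1) .N2 (show A.n ≤ _ by omega)
      (by funext r; cases r <;> rfl)).bind
    ((exec_inc_header .N2 (show A.n + 1 ≤ _ by omega)
      (by funext r; cases r <;> rfl)).bind exec_rewind))))))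

/-- The machine writes the encoding of the new instance. All registers are bounded by the length
`N` of the input, so that `log (N + 1) + 2` cells are enough. -/
theorem computesInSpace_reduction (A : TSInst) :
    reduction.toTransducer.ComputesInSpace A.encode A.toPTS.encode
      (Nat.log 2 (A.encode.length + 1) + 2) := by
  have h : reduction.Exec A.encode A.encode.length ⟨0, fun _ => 0, []⟩ ()
      ⟨0, env A.k A.n 0 0 0 0 0, A.toPTS.encode⟩ :=
    Exec.bind (G := fun _ => writeInstance) exec_readHeader (emits_writeInstance [])
  have hinit : reduction.toTransducer.initCfg =
      reduction.cfg (.inl reduction.start) (Mem.conf ⟨0, fun _ => 0, []⟩) := by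
    have : tapeOf [] = fun _ => none := by
      funext p; cases p <;> rfl
    simp only [Transducer.initCfg, cfg, Mem.conf, digits, this]
    rfl
  have hr := (h (Nat.zero_le _)).2.reaches fun _ => Nat.succ_pos _
  exact ⟨⟨_, hinit ▸ hr.1, rfl, rfl⟩, hinit ▸ hr.2⟩

end Output

theorem isPLReduction_toPTS :
    IsPLReduction TSIndepSetReconf PartTSIndepSetReconf TSInst.toPTS := by
  refine ⟨fun A => ⟨fun ⟨ℓ, h⟩ => ⟨_, TSInst.Admits.toPTS h⟩, fun ⟨m, h⟩ => ?_⟩,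
    ⟨Nat.succ, Primrec.succ.to_comp, fun A => le_rfl⟩,
    ⟨fun _ => 1, Computable.const 1, reduction.toTransducer, 3, fun A => ?_⟩⟩
  · obtain ⟨ℓ, -, h⟩ := TSInst.exists_admits_of_toPTS h
    exact ⟨ℓ, h⟩
  · have h := computesInSpace_reduction A
    refine ⟨h.1, fun c hc r => (h.2 c hc r).trans_le ?_⟩
    -- The encoding is not empty, so adding 1 to its length adds at most 1 to the logarithm.
    have hlog : Nat.log 2 (A.encode.length + 1) ≤ Nat.log 2 A.encode.length + 1 := by
      have := A.le_length_encode
      rw [← Nat.log_mul_base (by norm_num) (by omega)]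
      exact Nat.log_mono_right (by omega)
    change _ ≤ 3 * (1 + Nat.log 2 A.encode.length)
    omega

end Reconf

theorem mainTheorem3 :
    ∃ f : Reconf.TSInst → Reconf.PTSInst,
      Reconf.IsPLReduction Reconf.TSIndepSetReconf Reconf.PartTSIndepSetReconf f ∧
      ∀ A : Reconf.TSInst,
        (∀ ℓ : ℕ, (∃ m ≤ ℓ, A.Admits m) ↔ ∃ m ≤ ℓ + A.k + 1, (f A).Admits m) ∧
        (∀ ℓ : ℕ, A.Admits ℓ → (f A).Admits (ℓ + A.k + 1)) := by
  refine ⟨Reconf.TSInst.toPTS, Reconf.isPLReduction_toPTS, fun A => ⟨fun ℓ => ⟨?_, ?_⟩,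
    fun ℓ h => h.toPTS⟩⟩
  · rintro ⟨m, hm, h⟩
    exact ⟨_, by omega, h.toPTS⟩
  · rintro ⟨m, hm, h⟩
    obtain ⟨ℓ', hℓ', h'⟩ := Reconf.TSInst.exists_admits_of_toPTS h
    exact ⟨ℓ', by omega, h'⟩
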